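/- **Setting.** A virtual knot is an equivalence class of diagrams of oriented circles on closed connected oriented surfaces under orientation-preserving homeomorphisms, Reidemeister moves and (de)stabilizations; equivalently, an equivalence class of Gauss diagrams (an oriented circle with finitely many signed chords, each oriented from its over-end to its under-end) under Reidemeister moves. Let $D$ be a diagram of a virtual knot $K$ with crossings $c_1,\dots,c_n$ of signs $\varepsilon_1,\dots,\varepsilon_n$, and let $\gamma_i$ (resp. $\overline{\gamma}_i$) be the closed curve on the surface that runs along $D$ from the over-crossing to the under-crossing (resp. from the under-crossing to the over-crossing) at $c_i$. For closed oriented curves $\alpha,\beta$ on the surface, $\alpha\cdot\beta\in\mathbb{Z}$ is their intersection number: after a perturbation that makes the curves transverse, each point where $\beta$ crosses $\alpha$ from left to right counts $+1$, and each point where it crosses from right to left counts $-1$. Put $\omega_D=\sum_i\varepsilon_i$ and $$W_K(t)=\sum_{i}\varepsilon_i\bigl(t^{\gamma_i\cdot\overline{\gamma}_i}-1\bigr),\qquad \overline{W}_K(t)=W_K(t)+W_K(t^{-1}),$$ $$f_{01}(D;t)=\sum_{i,j}\varepsilon_i\varepsilon_j\bigl(t^{\gamma_i\cdot\overline{\gamma}_j}-1\bigr),\quad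 f_{00}(D;t)=\sum_{i,j}\varepsilon_i\varepsilon_j\bigl(t^{\gamma_i\cdot\gamma_j}-1\bigr),\quad f_{11}(D;t)=\sum_{i,j}\varepsilon_i\varepsilon_j\bigl(t^{\overline{\gamma}_i\cdot\overline{\gamma}_j}-1\bigr).$$ The intersection polynomials of $K$, computed from any diagram $D$ of $K$, are $$I_K(t)=f_{01}(D;t)-\omega_D W_K(t),\qquad I\!I_K(t)=f_{00}(D;t)+f_{11}(D;t)-\omega_D\overline{W}_K(t),$$ and $I\!I\!I_K(t)$ is the class $\{f_{00}(D;t)+m\,\overline{W}_K(t): m\in\mathbb{Z}\}$. The degree $\deg$ of a Laurent polynomial is its maximal exponent ($-\infty$ for the zero polynomial), and $\deg I\!I\!I_K(t)$ is the maximal degree of a member of the class. A virtual diagram is a generic closed curve in the plane each of whose double points is either a real crossing, with over/under-information, or a virtual crossing; it presents the virtual knot of the Gauss diagram formed by its real crossings. The virtual crossing number $\mathrm{vc}(K)$ is the minimal number of virtual crossings among all virtual diagrams of $K$. **Proposition 5.4.** For any virtual knot $K$, 1. $\mathrm{vc}(K)\ge\deg I_K(t)$, 2. $\mathrm{vc}(K)\ge\deg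 I\!I_K(t)$, 3. $\mathrm{vc}(K)\ge\deg I\!I\!I_K(t)$. -/

import Mathlib

/-!
Virtual knots as Gauss diagrams modulo Reidemeister moves, the closed oriented surface that carries
a Gauss diagram, intersection numbers of cycles on this surface, the intersection polynomials, and
planar virtual diagrams.
-/

namespace VirtualKnots

/-! ### Gauss diagrams -/

/-- A passage of the oriented curve through one of its crossings: the name of the crossing,
whether the curve passes as the over-strand, and whether the crossing is positive, that is,
whether the tangent directions (over-strand, under-strand) form a positive frame of the surface. -/
@[ext] structure Letter where
  label : ℕ
  isOver : Bool
  pos : Bool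
deriving DecidableEq

/-- The other passage through the same crossing (the other end of the chord). -/
def Letter.partner (l : Letter) : Letter := ⟨l.label, !l.isOver, l.pos⟩

/-- The sign `ε = ±1` of the crossing. -/
def Letter.sign (l : Letter) : ℤ := if l.pos then 1 else -1

/-- A cyclic word of passages in which every occurring crossing is passed exactly twice, once over
and once under, with one and the same sign. -/
structure IsGaussCode (w : List Letter) : Prop where
  nodup : w.Nodup
  partner_mem : ∀ l ∈ w, l.partner ∈ w
  pos_eq : ∀ l ∈ w, ∀ l' ∈ w, l.label = l'.label → l.pos = l'.pos

/-- A Gauss diagram: a circle with finitely many signed chords, oriented from the over-end to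
the under-end, read off as the sequence of chord ends along the circle from some base point.
It records a diagram on a closed connected oriented surface up to orientation-preserving
homeomorphisms and up to (de)stabilizations away from the diagram.
The empty word is the diagram without crossings. -/
structure GaussDiagram where
  code : List Letter
  isGaussCode : IsGaussCode code

/-- Two consecutive chord ends `x`, `y`, in this order or in the opposite one. -/
def seg (forward : Bool) (x y : Letter) : List Letter := if forward then [x, y] else [y, x]

/-- The sign of a triangle in which the strands `S`, `S'` run along (`true`) or against (`false`)
the reference directions of its sides; `κ` is the orientation of the triangle. -/
def triSign (κ s s' : Bool) : Bool := xor κ (xor s s')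

/-- Elementary changes of a Gauss code. -/
inductive Step : List Letter → List Letter → Prop
  /-- change of the base point -/
  | rotate (u v : List Letter) : Step (u ++ v) (v ++ u)
  /-- renaming of the crossings -/
  | relabel (f : ℕ → ℕ) (hf : Function.Injective f) (w : List Letter) :
      Step w (w.map fun l => ⟨f l.label, l.isOver, l.pos⟩)
  /-- First Reidemeister move, all four kinds: an isolated chord is removed. -/
  | r1 (c : ℕ) (o p : Bool) (w : List Letter) :
      Step (⟨c, o, p⟩ :: ⟨c, !o, p⟩ :: w) w
  /-- Second Reidemeister move: two crossings of opposite signs at which one strand passes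
  over another one. The order `d` in which the under-strand meets them says whether
  the two strands run in parallel or in opposite directions. -/
  | r2 (a b : ℕ) (p d : Bool) (u v : List Letter) :
      Step (seg true ⟨a, true, p⟩ ⟨b, true, !p⟩ ++ u ++
            seg d ⟨a, false, p⟩ ⟨b, false, !p⟩ ++ v)
           (u ++ v)
  /-- Third Reidemeister move: a top strand `T`, a middle strand `M` and a bottom strand `B` bound
  a triangle with the vertices `a = T ∩ M`, `b = T ∩ B`, `c = M ∩ B`. With reference
  directions `a → b` on `T`, `a → c` on `M` and `b → c` on `B`, the Booleans `t`, `m`, `e` say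
  whether the strands follow them, and `κ` whether the triangle `a b c` is positively oriented;
  they determine the three signs. The move reverses the order of the two crossings on each of
  the strands and keeps the signs. Here the knot runs through `T`, `M`, `B` in this order. -/
  | r3 (a b c : ℕ) (κ t m e : Bool) (u v w : List Letter) :
      Step (seg t ⟨a, true, triSign κ t m⟩ ⟨b, true, triSign κ t e⟩ ++ u ++
            seg m ⟨a, false, triSign κ t m⟩ ⟨c, true, triSign κ m e⟩ ++ v ++
            seg e ⟨b, false, triSign κ t e⟩ ⟨c, false, triSign κ m e⟩ ++ w)
           (seg (!t) ⟨a, true, triSign κ t m⟩ ⟨b, true, triSign κ t e⟩ ++ u ++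
            seg (!m) ⟨a, false, triSign κ t m⟩ ⟨c, true, triSign κ m e⟩ ++ v ++
            seg (!e) ⟨b, false, triSign κ t e⟩ ⟨c, false, triSign κ m e⟩ ++ w)
  /-- The same move where the knot runs through `T`, `B`, `M` in this order. -/
  | r3' (a b c : ℕ) (κ t m e : Bool) (u v w : List Letter) :
      Step (seg t ⟨a, true, triSign κ t m⟩ ⟨b, true, triSign κ t e⟩ ++ u ++
            seg e ⟨b, false, triSign κ t e⟩ ⟨c, false, triSign κ m e⟩ ++ v ++
            seg m ⟨a, false, triSign κ t m⟩ ⟨c, true, triSign κ m e⟩ ++ w)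
           (seg (!t) ⟨a, true, triSign κ t m⟩ ⟨b, true, triSign κ t e⟩ ++ u ++
            seg (!e) ⟨b, false, triSign κ t e⟩ ⟨c, false, triSign κ m e⟩ ++ v ++
            seg (!m) ⟨a, false, triSign κ t m⟩ ⟨c, true, triSign κ m e⟩ ++ w)

/-- An elementary change from one Gauss diagram to another (both sides are Gauss codes, so that in
particular crossings created by a move carry new names). -/
def Move (D D' : GaussDiagram) : Prop := Step D.code D'.code

/-- A virtual knot: a class of Gauss diagrams under the equivalence relation generated by the
Reidemeister moves. -/
def VirtualKnot : Type := Quot Move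

/-- `D` is a diagram of the virtual knot `K`. -/
def GaussDiagram.Presents (D : GaussDiagram) (K : VirtualKnot) : Prop := Quot.mk Move D = K

/-! ### The surface of a diagram

At a crossing four half-edges meet: the over- and the under-strand, incoming and outgoing.
A neighbourhood of the curve is the oriented ribbon surface in which these half-edges are arranged
counterclockwise as `slot` prescribes, and a closed connected oriented surface arises from it
by gluing a disk to each boundary circle. -/

/-- The position `0, 1, 2, 3`, in counterclockwise order, of a half-edge at a crossing of sign `pos`;
`isOver` tells the strand and `out` whether the half-edge leaves the crossing.
At a positive crossing the order is: over-out, under-out, over-in, under-in;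
at a negative one: over-out, under-in, over-in, under-out. -/
def slot (pos isOver out : Bool) : ℕ :=
  if isOver then (if out then 0 else 2) else (if xor pos out then 3 else 1)

/-- A half-edge of the diagram, given by a passage and by whether it leaves or enters. -/
@[ext] structure HalfEdge where
  letter : Letter
  out : Bool
deriving DecidableEq

/-- The next half-edge at the same crossing in counterclockwise order. -/
def HalfEdge.turn (h : HalfEdge) : HalfEdge :=
  ⟨h.letter.partner, xor h.out (xor h.letter.isOver h.letter.pos)⟩

theorem HalfEdge.slot_turn (h : HalfEdge) :
    slot h.turn.letter.pos h.turn.letter.isOver h.turn.out =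
      (slot h.letter.pos h.letter.isOver h.out + 1) % 4 := by
  obtain ⟨⟨c, o, p⟩, b⟩ := h
  cases o <;> cases p <;> cases b <;> simp [HalfEdge.turn, Letter.partner, slot]

/-- The other half of the same edge: an outgoing half-edge is continued by the incoming
half-edge at the cyclically next passage. -/
def HalfEdge.opposite (w : List Letter) (h : HalfEdge) : HalfEdge :=
  if h.out then ⟨w.formPerm h.letter, false⟩ else ⟨w.formPerm.symm h.letter, true⟩

/-- Walk along an edge and turn: this runs once around the boundary of a face. -/
def HalfEdge.face (w : List Letter) (h : HalfEdge) : HalfEdge := (h.opposite w).turn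

/-- The number of faces, that is, of cycles of `HalfEdge.face`. -/
noncomputable def numFaces (w : List Letter) : ℕ :=
  Nat.card (Quot fun h h' : {h : HalfEdge // h.letter ∈ w} => h'.1 = h.1.face w)

/-- The passages over a crossing; they list every crossing once. -/
def overs (w : List Letter) : List Letter := w.filter fun l => l.isOver

/-- The curve lies on the sphere or, equivalently, in the plane: it has no crossings, or the
closed surface made from its connected 4-valent graph has Euler characteristic `V - E + F = 2`,
where `E = w.length`, as every passage is followed by one edge. -/
def IsPlanar (w : List Letter) : Prop :=
  w = [] ∨ ((overs w).length : ℤ) - w.length + numFaces w = 2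

/-! ### Cycles and intersection numbers -/

/-- A passage of a cycle through a crossing: it enters by the half-edge at position `enter`
and leaves by the one at position `leave`. -/
structure Pass where
  label : ℕ
  enter : ℕ
  leave : ℕ

/-- Going straight through a crossing. -/
def Letter.straight (l : Letter) : Pass :=
  ⟨l.label, slot l.pos l.isOver false, slot l.pos l.isOver true⟩

/-- The passages strictly after `x` and strictly before `y` along the cyclic word `w`. -/
def between (w : List Letter) (x y : Letter) : List Letter :=
  (w.rotate (w.idxOf x + 1)).takeWhile fun l => l ≠ y

/-- The closed curve that starts at the passage `x` of a crossing, follows the knot to the other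
passage through that crossing, and there turns back to its start. For an over-passage `x` this is
the cycle `γ` from the over-crossing to the under-crossing. -/
def cycleFrom (w : List Letter) (x : Letter) : List Pass :=
  ⟨x.label, slot x.pos x.partner.isOver false, slot x.pos x.isOver true⟩ ::
    (between w x x.partner).map Letter.straight

/-- On a circle with twelve points `0, …, 11` in counterclockwise order: whether the point `p` lies
on the right of the chord from `x` to `y`, that is, on the open arc from `x`
counterclockwise to `y`. -/
def onRight (x y p : ℕ) : Bool := (p + 12 - x) % 12 < (y + 12 - x) % 12

/-- The intersection number of two passages after the second curve has been pushed off to its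
left. On the boundary circle of a disk around the crossing, the half-edge at position `k` meets
the point `3 * k`; the pushed-off curve enters at `3 * k - 1` and leaves at `3 * k + 1`. It counts
`+1` if the second curve crosses the first one from left to right and `-1` if it crosses from
right to left. -/
def localIntersection (p q : Pass) : ℤ :=
  if p.label = q.label then
    (if onRight (3 * p.enter) (3 * p.leave) ((3 * q.leave + 1) % 12) then 1 else 0) -
      (if onRight (3 * p.enter) (3 * p.leave) ((3 * q.enter + 11) % 12) then 1 else 0)
  else 0

/-- The intersection number `α · β` of two cycles on the surface of a diagram: the second curve is
pushed off to its left, the transverse double points, all of which lie near crossings,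
are counted with signs. -/
def intersection (α β : List Pass) : ℤ :=
  (α.map fun p => (β.map fun q => localIntersection p q).sum).sum

namespace GaussDiagram

/-- The crossings of `D`, represented by their over-passages. -/
def crossings (D : GaussDiagram) : List Letter := overs D.code

/-- The cycle `γ` at a crossing, from the over-crossing to the under-crossing. -/
def gam (D : GaussDiagram) (x : Letter) : List Pass := cycleFrom D.code x

/-- The cycle `γ̄` at a crossing, from the under-crossing to the over-crossing. -/
def gamBar (D : GaussDiagram) (x : Letter) : List Pass := cycleFrom D.code x.partner

open LaurentPolynomial

/-- `∑ i, ε i * (t ^ (γ i · γ̄ i) - 1)`, the writhe polynomial. -/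
noncomputable def W (D : GaussDiagram) : ℤ[T;T⁻¹] :=
  (D.crossings.map fun x => x.sign • (T (intersection (D.gam x) (D.gamBar x)) - 1)).sum

/-- `W(t) + W(t⁻¹)` -/
noncomputable def Wbar (D : GaussDiagram) : ℤ[T;T⁻¹] := D.W + invert D.W

/-- `∑ i j, ε i * ε j * (t ^ (α i · β j) - 1)` for families of cycles `α`, `β` -/
noncomputable def f (D : GaussDiagram) (α β : Letter → List Pass) : ℤ[T;T⁻¹] :=
  (D.crossings.map fun x => (D.crossings.map fun y =>
    (x.sign * y.sign) • (T (intersection (α x) (β y)) - 1)).sum).sum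

noncomputable def f01 (D : GaussDiagram) : ℤ[T;T⁻¹] := D.f D.gam D.gamBar

noncomputable def f00 (D : GaussDiagram) : ℤ[T;T⁻¹] := D.f D.gam D.gam

noncomputable def f11 (D : GaussDiagram) : ℤ[T;T⁻¹] := D.f D.gamBar D.gamBar

/-- The writhe, the sum of the signs of the crossings. -/
def writhe (D : GaussDiagram) : ℤ := (D.crossings.map Letter.sign).sum

/-- The first intersection polynomial. -/
noncomputable def polyI (D : GaussDiagram) : ℤ[T;T⁻¹] := D.f01 - D.writhe • D.W

/-- The second intersection polynomial. -/
noncomputable def polyII (D : GaussDiagram) : ℤ[T;T⁻¹] := D.f00 + D.f11 - D.writhe • D.Wbar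

/-- The third intersection polynomial: the class of `f00` modulo integer multiples of `Wbar`. -/
def classIII (D : GaussDiagram) : Set ℤ[T;T⁻¹] := {g | ∃ m : ℤ, g - D.f00 = m • D.Wbar}

end GaussDiagram

open LaurentPolynomial in
/-- The maximal degree of a Laurent polynomial (`⊥ = -∞` for the zero polynomial). -/
noncomputable def maxDeg (g : ℤ[T;T⁻¹]) : EReal := g.coeff.support.sup fun n : ℤ => ((n : ℝ) : EReal)

open LaurentPolynomial in
/-- The maximal degree of the members of a class of Laurent polynomials. -/
noncomputable def maxDegClass (S : Set ℤ[T;T⁻¹]) : EReal := ⨆ g ∈ S, maxDeg g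

/-! ### Planar virtual diagrams -/

theorem IsGaussCode.filter {w : List Letter} (h : IsGaussCode w) (s : ℕ → Bool) :
    IsGaussCode (w.filter fun l => s l.label) where
  nodup := h.nodup.filter _
  partner_mem l hl := by
    rw [List.mem_filter] at hl ⊢
    exact ⟨h.partner_mem l hl.1, hl.2⟩
  pos_eq l hl l' hl' := h.pos_eq l (List.mem_filter.1 hl).1 l' (List.mem_filter.1 hl').1

/-- A virtual diagram in the plane: a planar closed curve with finitely many transverse double
points, each of which is a real crossing or a virtual one. The curve is recorded by the
Gauss code of all its double points; at a virtual crossing the words over and under are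
a mere naming of its two strands and `pos` records the local orientation of this ordered pair. -/
structure VirtualDiagram where
  curve : GaussDiagram
  planar : IsPlanar curve.code
  isVirtual : ℕ → Bool

/-- The Gauss diagram of a virtual diagram: only the real crossings give chords. -/
def VirtualDiagram.gaussDiagram (V : VirtualDiagram) : GaussDiagram :=
  ⟨V.curve.code.filter fun l => !V.isVirtual l.label,
    V.curve.isGaussCode.filter fun c => !V.isVirtual c⟩

/-- The number of virtual crossings. -/
def VirtualDiagram.numVirtual (V : VirtualDiagram) : ℕ :=
  ((overs V.curve.code).filter fun l => V.isVirtual l.label).length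

/-- The virtual crossing number `vc(K)`: the minimum of the number of virtual crossings over all
virtual diagrams of `K` (taken in `ℕ∞`, where the infimum of a nonempty family is attained). -/
noncomputable def virtualCrossingNumber (K : VirtualKnot) : ℕ∞ :=
  ⨅ (V : VirtualDiagram) (_ : V.gaussDiagram.Presents K), (V.numVirtual : ℕ∞)

end VirtualKnots

namespace VirtualKnots

/-! ### Chains along a cyclic word -/

/-! A cycle `γ` or `γ̄` is determined by its multiplicities, all 0 or 1, on the edges of the knot,
and these jump only at the crossing where the cycle turns. In these terms an intersection number is
a sum over crossings (`intersection_eq_pairing`); a crossing that both cycles pass straight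
contributes, up to sign, the determinant of the two pairs of multiplicities on its strands.

Let `w` be the code of all double points of a planar virtual diagram and `v` the subword of its real
crossings. Cycles at real crossings go straight through the virtual ones, so they have the same
multiplicities in `v` and in `w`, and their intersection number in `w` is the one in `v` plus the
contributions of the virtual crossings. The number in `w` is 0: on the sphere every cycle is a
boundary (`range_boundary_eq`, a rank count with the Euler characteristic), and a boundary has
intersection number 0 with every cycle (`pairing_eq_zero_of_isPlanar`). A 2 × 2 determinant with
entries 0 and 1 has absolute value at most 1. Hence every intersection number of cycles in `v` is
bounded in absolute value by the number of virtual crossings (`VirtualDiagram.abs_linking_le`). All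
exponents in the polynomials of this diagram are such numbers or their negatives, so the degrees are
bounded as well.

It remains to pass from a minimal virtual diagram to the given diagram, that is, to prove invariance
(`Step.samePolys`). Intersection numbers are antisymmetric and `γ + γ̄` is the whole knot, so every
exponent is expressed by the numbers `linking` (`γ x · γ y`) and `index` (`γ x` with the knot). The
third move preserves both. The second removes two crossings of opposite signs whose cycles are
homologous, and they cancel. The first removes a crossing whose `γ` is homologous to zero or to the
knot; its row and column are compensated by the change of the writhe in the first two polynomials,
and change `f00` by nothing or by a multiple of `Wbar`, which the class ignores (`samePolys_cons`).
-/

@[simp] theorem Letter.partner_partner (l : Letter) : l.partner.partner = l := by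
  simp [Letter.partner]

theorem Letter.partner_ne (l : Letter) : l.partner ≠ l := by
  intro h
  have := congrArg Letter.isOver h
  simp [Letter.partner] at this

theorem Letter.ne_partner (l : Letter) : l ≠ l.partner := fun h => l.partner_ne h.symm

theorem Letter.partner_inj {l m : Letter} : l.partner = m.partner ↔ l = m :=
  ⟨fun h => by simpa using congrArg Letter.partner h, fun h => h ▸ rfl⟩

theorem Letter.partner_eq_comm {l m : Letter} : l.partner = m ↔ l = m.partner :=
  ⟨fun h => h ▸ (by simp), fun h => h ▸ (by simp)⟩

@[simp] theorem Letter.partner_label (l : Letter) : l.partner.label = l.label := rfl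
@[simp] theorem Letter.partner_isOver (l : Letter) : l.partner.isOver = !l.isOver := rfl
@[simp] theorem Letter.partner_pos (l : Letter) : l.partner.pos = l.pos := rfl

/-- The sum of `J` over the letters of `w` before the first occurrence of `s`. -/
def sumBefore (w : List Letter) (J : Letter → ℤ) (s : Letter) : ℤ :=
  ((w.takeWhile fun l => l ≠ s).map J).sum

@[simp] theorem sumBefore_nil (J : Letter → ℤ) (s : Letter) : sumBefore [] J s = 0 := rfl

@[simp] theorem sumBefore_cons_self (w : List Letter) (J : Letter → ℤ) (s : Letter) :
    sumBefore (s :: w) J s = 0 := by simp [sumBefore]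

theorem sumBefore_cons_of_ne {a s : Letter} (h : a ≠ s) (w : List Letter) (J : Letter → ℤ) :
    sumBefore (a :: w) J s = J a + sumBefore w J s := by simp [sumBefore, h]

theorem sumBefore_append_of_mem {u : List Letter} {s : Letter} (h : s ∈ u) (v : List Letter)
    (J : Letter → ℤ) : sumBefore (u ++ v) J s = sumBefore u J s := by
  induction u with
  | nil => simp at h
  | cons a u ih =>
    by_cases ha : a = s
    · subst ha; simp
    · rw [List.cons_append, sumBefore_cons_of_ne ha, sumBefore_cons_of_ne ha,
        ih ((List.mem_cons.1 h).resolve_left (Ne.symm ha))]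

theorem sumBefore_append_of_notMem {u : List Letter} {s : Letter} (h : s ∉ u) (v : List Letter)
    (J : Letter → ℤ) : sumBefore (u ++ v) J s = (u.map J).sum + sumBefore v J s := by
  induction u with
  | nil => simp
  | cons a u ih =>
    rw [List.mem_cons, not_or] at h
    rw [List.cons_append, sumBefore_cons_of_ne (Ne.symm h.1), ih h.2]
    simp [add_assoc]

/-- A one-chain along the knot: its multiplicity at the base point and its jumps at the
passages. -/
structure Chain where
  base : ℤ
  jump : Letter → ℤ

namespace Chain

/-- The multiplicity on the edge that enters the passage `s`. -/
def inflow (w : List Letter) (a : Chain) (s : Letter) : ℤ := a.base + sumBefore w a.jump s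

/-- The multiplicity on the edge that leaves the passage `s`. -/
def outflow (w : List Letter) (a : Chain) (s : Letter) : ℤ := a.inflow w s + a.jump s

/-- Kirchhoff's law at every crossing. -/
def IsCycle (a : Chain) : Prop := ∀ l, a.jump l.partner = -a.jump l

end Chain

/-- Whether the strand is the first one in the positive frame of its crossing. -/
def Letter.isFirst (l : Letter) : Bool := l.isOver == l.pos

@[simp] theorem Letter.isFirst_partner (l : Letter) : l.partner.isFirst = !l.isFirst := by
  obtain ⟨c, o, p⟩ := l
  cases o <;> cases p <;> rfl

/-- The contribution of the passage `l` to the intersection number of two chains. -/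
def pairingAt (w : List Letter) (a b : Chain) (l : Letter) : ℤ :=
  if l.isFirst then a.outflow w l.partner * b.outflow w l
  else -(a.inflow w l.partner * b.inflow w l)

/-- The intersection number of two chains. -/
def pairing (w : List Letter) (a b : Chain) : ℤ := (w.map (pairingAt w a b)).sum

/-- The jumps of the cycle that starts at the passage `x`. -/
def jumpAt (x l : Letter) : ℤ := (if l = x then 1 else 0) - (if l = x.partner then 1 else 0)

/-- The cycle that runs from `x` to its partner. -/
def loop (w : List Letter) (x : Letter) : Chain := ⟨-sumBefore w (jumpAt x) x, jumpAt x⟩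

/-- The whole knot. -/
def knotChain : Chain := ⟨1, fun _ => 0⟩

theorem jumpAt_self (x : Letter) : jumpAt x x = 1 := by simp [jumpAt, x.ne_partner]

theorem jumpAt_partner_self (x : Letter) : jumpAt x x.partner = -1 := by
  simp [jumpAt, x.partner_ne]

theorem jumpAt_of_ne {x l : Letter} (h : l ≠ x) (h' : l ≠ x.partner) : jumpAt x l = 0 := by
  simp [jumpAt, h, h']

theorem jumpAt_partner_left (x l : Letter) : jumpAt x.partner l = -jumpAt x l := by
  simp [jumpAt]

theorem loop_isCycle (w : List Letter) (x : Letter) : (loop w x).IsCycle := by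
  intro l
  simp [loop, jumpAt, Letter.partner_eq_comm]

theorem knotChain_isCycle : knotChain.IsCycle := fun _ => by simp [knotChain]

@[simp] theorem inflow_knotChain (w : List Letter) (s : Letter) : knotChain.inflow w s = 1 := by
  simp [Chain.inflow, knotChain, sumBefore]

theorem sum_map_jumpAt_of_notMem {u : List Letter} {x : Letter} (h : x ∉ u) (h' : x.partner ∉ u) :
    (u.map (jumpAt x)).sum = 0 := by
  apply List.sum_eq_zero
  intro z hz
  obtain ⟨l, hl, rfl⟩ := List.mem_map.1 hz
  exact jumpAt_of_ne (fun e => h (e ▸ hl)) (fun e => h' (e ▸ hl))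

theorem sumBefore_jumpAt_of_notMem {u : List Letter} {x : Letter} (h : x ∉ u)
    (h' : x.partner ∉ u) (s : Letter) : sumBefore u (jumpAt x) s = 0 :=
  sum_map_jumpAt_of_notMem (fun e => h ((List.takeWhile_sublist _).subset e))
    (fun e => h' ((List.takeWhile_sublist _).subset e))

/-- A word that contains `x` and `y` once each, split at these letters. -/
theorem exists_split {w : List Letter} (hw : w.Nodup) {x y : Letter} (hx : x ∈ w) (hy : y ∈ w)
    (hxy : x ≠ y) :
    (∃ A B C, w = A ++ x :: (B ++ y :: C)) ∨ (∃ A B C, w = A ++ y :: (B ++ x :: C)) := by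
  obtain ⟨A, B, rfl⟩ := List.append_of_mem hx
  rcases List.mem_append.1 hy with h | h
  · right
    obtain ⟨C, D, rfl⟩ := List.append_of_mem h
    exact ⟨C, D, B, by simp⟩
  · left
    obtain ⟨C, D, rfl⟩ := List.append_of_mem ((List.mem_cons.1 h).resolve_left hxy.symm)
    exact ⟨A, C, D, by simp⟩

theorem between_of_split {A B C : List Letter} {x y : Letter}
    (hw : (A ++ x :: (B ++ y :: C)).Nodup) : between (A ++ x :: (B ++ y :: C)) x y = B := by
  have hxA : x ∉ A := by
    intro h; simp [List.nodup_append] at hw; grind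
  have hyB : ∀ l ∈ B, l ≠ y := by
    intro l h; simp [List.nodup_append] at hw; grind
  have e : (A ++ x :: (B ++ y :: C)).idxOf x + 1 = (A ++ [x]).length := by
    rw [List.idxOf_append_of_notMem hxA]; simp
  rw [between, e, show A ++ x :: (B ++ y :: C) = (A ++ [x]) ++ (B ++ y :: C) by simp,
    List.rotate_append_length_eq, List.append_assoc, List.takeWhile_append_of_pos (by simpa using hyB)]
  simp

theorem between_of_split' {A B C : List Letter} {x y : Letter}
    (hw : (A ++ y :: (B ++ x :: C)).Nodup) : between (A ++ y :: (B ++ x :: C)) x y = C ++ A := by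
  have hxA : x ∉ A ++ y :: B := by
    intro h; simp [List.nodup_append] at hw h; grind
  have hyB : ∀ l ∈ C ++ A, l ≠ y := by
    intro l h; simp [List.nodup_append] at hw h; grind
  have e : (A ++ y :: (B ++ x :: C)).idxOf x + 1 = (A ++ y :: (B ++ [x])).length := by
    rw [show A ++ y :: (B ++ x :: C) = (A ++ y :: B) ++ x :: C by simp,
      List.idxOf_append_of_notMem hxA]; simp; omega
  rw [between, e, show A ++ y :: (B ++ x :: C) = (A ++ y :: (B ++ [x])) ++ C by simp,
    List.rotate_append_length_eq, ← List.append_assoc,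
    List.takeWhile_append_of_pos (by simpa using hyB)]
  simp

/-- The multiplicities of the cycle that starts at `x` are `1` along the way to the partner. -/
theorem inflow_loop {w : List Letter} (hw : w.Nodup) {x : Letter} (hx : x ∈ w)
    (hx' : x.partner ∈ w) {l : Letter} (hl : l ∈ w) :
    (loop w x).inflow w l =
      (if l ∈ between w x x.partner then 1 else 0) + if l = x.partner then 1 else 0 := by
  have hne := x.ne_partner
  -- In the first case the arc from `x` to its partner avoids the base point and the base
  -- multiplicity is 0. In the second it runs through the base point and the base multiplicity is 1.
  rcases exists_split hw hx hx' hne with ⟨A, B, C, rfl⟩ | ⟨A, B, C, rfl⟩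
  · rw [between_of_split hw]
    have hd := hw
    simp only [List.nodup_append, List.nodup_cons, List.mem_append, List.mem_cons, not_or] at hd
    have hA : x ∉ A := fun h => by grind
    have hA' : x.partner ∉ A := fun h => by grind
    have hB : x ∉ B := fun h => by grind
    have hB' : x.partner ∉ B := fun h => by grind
    have hC : x ∉ C := fun h => by grind
    have hC' : x.partner ∉ C := fun h => by grind
    simp only [Chain.inflow, loop]
    rw [sumBefore_append_of_notMem hA, sumBefore_cons_self, sum_map_jumpAt_of_notMem hA hA']
    simp only [List.mem_append, List.mem_cons] at hl
    by_cases h1 : l ∈ A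
    · rw [sumBefore_append_of_mem h1, sumBefore_jumpAt_of_notMem hA hA']
      have : l ∉ B := by grind
      have : l ≠ x.partner := by grind
      simp [*]
    rw [sumBefore_append_of_notMem h1, sum_map_jumpAt_of_notMem hA hA']
    by_cases h2 : l = x
    · subst h2; simp [hB, hne]
    rw [sumBefore_cons_of_ne (Ne.symm h2), jumpAt_self]
    by_cases h3 : l ∈ B
    · rw [sumBefore_append_of_mem h3, sumBefore_jumpAt_of_notMem hB hB']
      have : l ≠ x.partner := by grind
      simp [*]
    rw [sumBefore_append_of_notMem h3, sum_map_jumpAt_of_notMem hB hB']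
    by_cases h4 : l = x.partner
    · subst h4; simp [hB']
    rw [sumBefore_cons_of_ne (Ne.symm h4), jumpAt_partner_self, sumBefore_jumpAt_of_notMem hC hC']
    simp [h3, h4]
  · rw [between_of_split' hw]
    have hd := hw
    simp only [List.nodup_append, List.nodup_cons, List.mem_append, List.mem_cons, not_or] at hd
    have hA : x ∉ A := fun h => by grind
    have hA' : x.partner ∉ A := fun h => by grind
    have hB : x ∉ B := fun h => by grind
    have hB' : x.partner ∉ B := fun h => by grind
    have hC : x ∉ C := fun h => by grind
    have hC' : x.partner ∉ C := fun h => by grind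
    simp only [Chain.inflow, loop]
    rw [sumBefore_append_of_notMem hA, sumBefore_cons_of_ne hne.symm,
      sumBefore_append_of_notMem hB, sumBefore_cons_self, sum_map_jumpAt_of_notMem hA hA',
      sum_map_jumpAt_of_notMem hB hB', jumpAt_partner_self]
    simp only [List.mem_append, List.mem_cons] at hl
    by_cases h1 : l ∈ A
    · rw [sumBefore_append_of_mem h1, sumBefore_jumpAt_of_notMem hA hA']
      have : l ≠ x.partner := by grind
      simp [*]
    rw [sumBefore_append_of_notMem h1, sum_map_jumpAt_of_notMem hA hA']
    by_cases h2 : l = x.partner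
    · subst h2; simp [hA', hC']
    rw [sumBefore_cons_of_ne (Ne.symm h2), jumpAt_partner_self]
    by_cases h3 : l ∈ B
    · rw [sumBefore_append_of_mem h3, sumBefore_jumpAt_of_notMem hB hB']
      have : l ∉ C := by grind
      simp [*]
    rw [sumBefore_append_of_notMem h3, sum_map_jumpAt_of_notMem hB hB']
    by_cases h4 : l = x
    · subst h4; simp [hA, hC, hne]
    rw [sumBefore_cons_of_ne (Ne.symm h4), jumpAt_self, sumBefore_jumpAt_of_notMem hC hC']
    have : l ∈ C := by grind
    simp [*]

theorem between_subset (w : List Letter) (x y : Letter) : between w x y ⊆ w := fun _ h =>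
  List.mem_rotate.1 ((List.takeWhile_sublist _).subset h)

theorem between_nodup {w : List Letter} (hw : w.Nodup) (x y : Letter) : (between w x y).Nodup :=
  (List.nodup_rotate.2 hw).sublist (List.takeWhile_sublist _)

theorem notMem_between (w : List Letter) (x y : Letter) : y ∉ between w x y := fun h => by
  have := List.mem_takeWhile_imp h
  simp at this

theorem sum_map_ite_mem {w v : List Letter} (hw : w.Nodup) (hv : v.Nodup) (h : v ⊆ w)
    (φ : Letter → ℤ) : (w.map fun l => (if l ∈ v then 1 else 0) * φ l).sum = (v.map φ).sum := by
  rw [← List.sum_toFinset _ hw, ← List.sum_toFinset _ hv]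
  simp only [ite_mul, one_mul, zero_mul]
  rw [← Finset.sum_filter]
  apply Finset.sum_congr _ fun _ _ => rfl
  ext l
  simpa using fun hl => h hl

theorem sum_map_ite_eq {w : List Letter} (hw : w.Nodup) {x : Letter} (hx : x ∈ w)
    (φ : Letter → ℤ) : (w.map fun l => (if l = x then 1 else 0) * φ l).sum = φ x := by
  simpa using sum_map_ite_mem hw (List.nodup_singleton x) (by simpa using hx) φ

theorem sum_map_add' (w : List Letter) (φ ψ : Letter → ℤ) :
    (w.map fun l => φ l + ψ l).sum = (w.map φ).sum + (w.map ψ).sum := List.sum_map_add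

theorem sum_map_sub' (w : List Letter) (φ ψ : Letter → ℤ) :
    (w.map fun l => φ l - ψ l).sum = (w.map φ).sum - (w.map ψ).sum := by
  induction w with
  | nil => simp
  | cons a w ih => simp only [List.map_cons, List.sum_cons, ih]; ring

theorem sum_map_jumpAt_mul {w : List Letter} (hw : w.Nodup) {x : Letter} (hx : x ∈ w)
    (hx' : x.partner ∈ w) (φ : Letter → ℤ) :
    (w.map fun l => jumpAt x l * φ l).sum = φ x - φ x.partner := by
  simp only [jumpAt, sub_mul, sum_map_sub', sum_map_ite_eq hw hx, sum_map_ite_eq hw hx']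

/-- Naming each edge by the passage that it enters, the edges of the cycle enter the passages of the
arc and, at the closing corner, `x.partner`. In the next lemma edges are named by the passage that
they leave, and the corner is left at `x`. -/
theorem sum_inflow_mul {w : List Letter} (hw : w.Nodup) {x : Letter} (hx : x ∈ w)
    (hx' : x.partner ∈ w) (φ : Letter → ℤ) :
    (w.map fun l => (loop w x).inflow w l * φ l).sum =
      ((between w x x.partner).map φ).sum + φ x.partner := by
  rw [List.map_congr_left (g := fun l => (if l ∈ between w x x.partner then 1 else 0) * φ l +
    (if l = x.partner then 1 else 0) * φ l)
    fun l hl => by rw [inflow_loop hw hx hx' hl, add_mul], sum_map_add',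
    sum_map_ite_mem hw (between_nodup hw _ _) (between_subset _ _ _), sum_map_ite_eq hw hx']

theorem sum_outflow_mul {w : List Letter} (hw : w.Nodup) {x : Letter} (hx : x ∈ w)
    (hx' : x.partner ∈ w) (φ : Letter → ℤ) :
    (w.map fun l => (loop w x).outflow w l * φ l).sum =
      ((between w x x.partner).map φ).sum + φ x := by
  simp only [Chain.outflow, add_mul, List.sum_map_add, sum_inflow_mul hw hx hx']
  rw [show (loop w x).jump = jumpAt x from rfl, sum_map_jumpAt_mul hw hx hx']
  ring

theorem inflow_loop_partner {w : List Letter} (hw : w.Nodup) {x : Letter} (hx : x ∈ w)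
    (hx' : x.partner ∈ w) : (loop w x).inflow w x.partner = 1 := by
  simp [inflow_loop hw hx hx' hx', notMem_between]

theorem inflow_loop_eq_zero_or_one {w : List Letter} (hw : w.Nodup) {x : Letter} (hx : x ∈ w)
    (hx' : x.partner ∈ w) {l : Letter} (hl : l ∈ w) :
    (loop w x).inflow w l = 0 ∨ (loop w x).inflow w l = 1 := by
  rw [inflow_loop hw hx hx' hl]
  by_cases h : l = x.partner
  · subst h; simp [notMem_between]
  · by_cases h2 : l ∈ between w x x.partner <;> simp [h, h2]

/-! ### Intersection numbers in terms of multiplicities -/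

theorem IsGaussCode.eq_or_eq_partner {w : List Letter} (hw : IsGaussCode w) {l m : Letter}
    (hl : l ∈ w) (hm : m ∈ w) (h : m.label = l.label) : m = l ∨ m = l.partner := by
  have hp := hw.pos_eq m hm l hl h
  by_cases ho : m.isOver = l.isOver
  · left; ext1 <;> assumption
  · right
    ext1
    · exact h
    · simpa [Bool.eq_not] using ho
    · exact hp

theorem IsGaussCode.sum_label {w : List Letter} (hw : IsGaussCode w) {x : Letter} (hx : x ∈ w)
    (φ : Letter → ℤ) (h : ∀ m ∈ w, m.label ≠ x.label → φ m = 0) :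
    (w.map φ).sum = φ x + φ x.partner := by
  have hx' := hw.partner_mem x hx
  rw [← sum_map_ite_eq hw.nodup hx φ, ← sum_map_ite_eq hw.nodup hx' φ, ← sum_map_add']
  congr 1
  apply List.map_congr_left
  intro m hm
  have hn := x.ne_partner
  by_cases hl : m.label = x.label
  · rcases hw.eq_or_eq_partner hx hm hl with rfl | rfl
    · simp [hn]
    · simp [hn.symm]
  · simp [h m hm hl]

/-- The passage that turns at `x`. -/
def corner (x : Letter) : Pass :=
  ⟨x.label, slot x.pos x.partner.isOver false, slot x.pos x.isOver true⟩

theorem cycleFrom_eq (w : List Letter) (x : Letter) :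
    cycleFrom w x = corner x :: (between w x x.partner).map Letter.straight := rfl

/-! ### Table of the local intersection numbers of straight passages and corners. -/

theorem localIntersection_of_ne {p q : Pass} (h : p.label ≠ q.label) :
    localIntersection p q = 0 := if_neg h

theorem localIntersection_straight_self (l : Letter) :
    localIntersection l.straight l.straight = 0 := by
  obtain ⟨c, o, p⟩ := l
  cases o <;> cases p <;> simp [localIntersection, Letter.straight, slot, onRight]

theorem localIntersection_partner_straight (l : Letter) :
    localIntersection l.partner.straight l.straight = if l.isFirst then 1 else -1 := by
  obtain ⟨c, o, p⟩ := l
  cases o <;> cases p <;>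
    simp [localIntersection, Letter.straight, slot, onRight, Letter.partner, Letter.isFirst]

theorem localIntersection_corner_straight (l : Letter) :
    localIntersection (corner l) l.straight = if l.isFirst then 0 else -1 := by
  obtain ⟨c, o, p⟩ := l
  cases o <;> cases p <;>
    simp [localIntersection, Letter.straight, slot, onRight, Letter.partner, Letter.isFirst, corner]

theorem localIntersection_corner_partner (l : Letter) :
    localIntersection (corner l) l.partner.straight = if l.isFirst then 0 else 1 := by
  obtain ⟨c, o, p⟩ := l
  cases o <;> cases p <;>
    simp [localIntersection, Letter.straight, slot, onRight, Letter.partner, Letter.isFirst, corner]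

theorem localIntersection_straight_corner (l : Letter) :
    localIntersection l.straight (corner l) = if l.isFirst then -1 else 0 := by
  obtain ⟨c, o, p⟩ := l
  cases o <;> cases p <;>
    simp [localIntersection, Letter.straight, slot, onRight, Letter.partner, Letter.isFirst, corner]

theorem localIntersection_partner_corner (l : Letter) :
    localIntersection l.partner.straight (corner l) = if l.isFirst then 1 else 0 := by
  obtain ⟨c, o, p⟩ := l
  cases o <;> cases p <;>
    simp [localIntersection, Letter.straight, slot, onRight, Letter.partner, Letter.isFirst, corner]

theorem localIntersection_corner_self (l : Letter) :
    localIntersection (corner l) (corner l) = 0 := by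
  obtain ⟨c, o, p⟩ := l
  cases o <;> cases p <;>
    simp [localIntersection, slot, onRight, Letter.partner, corner]

theorem localIntersection_corner_corner_partner (l : Letter) :
    localIntersection (corner l) (corner l.partner) = 0 := by
  obtain ⟨c, o, p⟩ := l
  cases o <;> cases p <;>
    simp [localIntersection, slot, onRight, Letter.partner, corner]

/-- The inflow weights treat the cycle as if it went straight on at `x.partner`, where in fact it
turns; the last bracket corrects this. With outflow weights, as in `sum_map_cycleFrom'`, the corner
is instead compared with the straight passage through `x`. -/
theorem sum_map_cycleFrom {w : List Letter} (hw : IsGaussCode w) {x : Letter} (hx : x ∈ w)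
    (φ : Pass → ℤ) :
    ((cycleFrom w x).map φ).sum = (w.map fun l => (loop w x).inflow w l * φ l.straight).sum +
      (φ (corner x) - φ x.partner.straight) := by
  rw [sum_inflow_mul hw.nodup hx (hw.partner_mem x hx), cycleFrom_eq]
  simp [List.map_map, Function.comp_def]
  ring

theorem sum_map_cycleFrom' {w : List Letter} (hw : IsGaussCode w) {x : Letter} (hx : x ∈ w)
    (φ : Pass → ℤ) :
    ((cycleFrom w x).map φ).sum = (w.map fun l => (loop w x).outflow w l * φ l.straight).sum +
      (φ (corner x) - φ x.straight) := by
  rw [sum_outflow_mul hw.nodup hx (hw.partner_mem x hx), cycleFrom_eq]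
  simp [List.map_map, Function.comp_def]
  ring

theorem sum_straight_straight {w : List Letter} (hw : IsGaussCode w) {l : Letter} (hl : l ∈ w)
    (g : Letter → ℤ) :
    (w.map fun m => g m * localIntersection l.straight m.straight).sum =
      g l.partner * if l.isFirst then -1 else 1 := by
  rw [hw.sum_label hl _ fun m _ h => by
    rw [localIntersection_of_ne (fun e => h e.symm), mul_zero]]
  have := localIntersection_partner_straight l.partner
  rw [Letter.partner_partner] at this
  rw [localIntersection_straight_self, this]
  cases h : l.isFirst <;> simp [h]

/-- The partner map permutes the letters of a Gauss code. This allows the two passages of each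
crossing to be combined or interchanged in a sum. -/
theorem sum_map_reindex {M : Type*} [AddCommMonoid M] {w : List Letter} (hw : IsGaussCode w)
    (φ : Letter → M) :
    (w.map fun l => φ l.partner).sum = (w.map φ).sum := by
  have : (w.map Letter.partner).Perm w := by
    rw [List.perm_ext_iff_of_nodup (hw.nodup.map fun a b h => Letter.partner_inj.1 h) hw.nodup]
    intro l
    rw [List.mem_map]
    constructor
    · rintro ⟨m, hm, rfl⟩
      exact hw.partner_mem m hm
    · exact fun h => ⟨_, hw.partner_mem l h, by simp⟩
  rw [← (this.map φ).sum_eq, List.map_map]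
  rfl

/-- The product of the two corner corrections. Passing from the corner at `x` to the straight
passage through `x.partner` changes only the outgoing half-edge, while at `y` only the incoming one
changes. Writing the first cycle with inflows and the second with outflows thus leaves no quadratic
correction. -/
theorem intersection_corner_correction {w : List Letter} (hw : IsGaussCode w) {x y : Letter}
    (hx : x ∈ w) (hy : y ∈ w) :
    localIntersection (corner x) (corner y) - localIntersection (corner x) y.straight -
      localIntersection x.partner.straight (corner y) +
      localIntersection x.partner.straight y.straight = 0 := by
  by_cases h : y.label = x.label
  · rcases hw.eq_or_eq_partner hx hy h with rfl | rfl
    · rw [localIntersection_corner_self, localIntersection_corner_straight,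
        localIntersection_partner_corner, localIntersection_partner_straight]
      cases y.isFirst <;> simp
    · rw [localIntersection_corner_corner_partner, localIntersection_corner_partner,
        localIntersection_straight_corner, localIntersection_straight_self]
      cases h : x.isFirst <;> simp [h]
  · have h' : x.label ≠ y.label := fun e => h e.symm
    rw [localIntersection_of_ne (p := corner x) (q := corner y) h',
      localIntersection_of_ne (p := corner x) (q := y.straight) h',
      localIntersection_of_ne (p := x.partner.straight) (q := corner y) h',
      localIntersection_of_ne (p := x.partner.straight) (q := y.straight) h']
    rfl

/-- Both sides are compared with the bilinear sum of inflows of the first cycle against outflows of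
the second over straight passages. On the left the remainder consists of corner corrections, on the
right of terms with the jumps at `x`, `y` and their partners; the local table shows that they agree.
-/
theorem intersection_eq_pairing {w : List Letter} (hw : IsGaussCode w) {x y : Letter}
    (hx : x ∈ w) (hy : y ∈ w) :
    intersection (cycleFrom w x) (cycleFrom w y) = pairing w (loop w x) (loop w y) := by
  have hx' := hw.partner_mem x hx
  have hy' := hw.partner_mem y hy
  rw [intersection, funext fun p => sum_map_cycleFrom' hw hy (localIntersection p),
    sum_map_cycleFrom hw hx]
  set F := (loop w x).inflow w
  set G := (loop w y).outflow w
  -- the contribution of the straight passages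
  have e1 : (w.map fun l => F l * ((w.map fun m =>
      G m * localIntersection l.straight m.straight).sum + (localIntersection l.straight (corner y) -
        localIntersection l.straight y.straight))).sum =
      (w.map fun m => F m.partner * (G m * if m.isFirst then 1 else -1)).sum +
      (F y * (localIntersection y.straight (corner y) - localIntersection y.straight y.straight) +
        F y.partner * (localIntersection y.partner.straight (corner y) -
          localIntersection y.partner.straight y.straight)) := by
    simp only [mul_add]
    rw [sum_map_add']
    congr 1
    · rw [← sum_map_reindex hw fun l => F l * _]
      congr 1
      apply List.map_congr_left
      intro m hm
      rw [sum_straight_straight hw (hw.partner_mem m hm)]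
      cases h : m.isFirst <;> simp [h]
    · rw [hw.sum_label hy _ fun m _ h => by
        rw [localIntersection_of_ne h, localIntersection_of_ne h]; simp]
  have e2 : ∀ p : Pass, p.label = x.label → (w.map fun m =>
      G m * localIntersection p m.straight).sum = G x * localIntersection p x.straight +
        G x.partner * localIntersection p x.partner.straight := by
    intro p hp
    rw [hw.sum_label hx _ fun m _ h => by
        rw [localIntersection_of_ne (by rw [hp]; exact fun e => h e.symm)]; simp]
  rw [e1, e2 _ rfl, e2 _ rfl]
  have e3 : pairing w (loop w x) (loop w y) =
      (w.map fun m => F m.partner * (G m * if m.isFirst then 1 else -1)).sum +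
      (w.map fun m => jumpAt x m * -(if m.isFirst then G m else 0)).sum +
      (w.map fun m => jumpAt y m * (if m.isFirst then 0 else F m.partner)).sum := by
    rw [pairing, ← sum_map_add', ← sum_map_add']
    congr 1
    apply List.map_congr_left
    intro m hm
    have hj : (loop w x).jump m.partner = -jumpAt x m := loop_isCycle w x m
    have hj' : (loop w y).inflow w m = G m - jumpAt y m := by
      simp only [G, Chain.outflow, loop]; ring
    rw [pairingAt, hj', Chain.outflow, hj]
    change (if _ then (F _ + _) * G m else -(F _ * _)) = _
    cases m.isFirst <;> simp <;> ring
  rw [e3, sum_map_jumpAt_mul hw.nodup hx hx', sum_map_jumpAt_mul hw.nodup hy hy']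
  have h4 := intersection_corner_correction hw hx hy
  rw [localIntersection_corner_straight, localIntersection_corner_partner,
    localIntersection_straight_corner, localIntersection_straight_self,
    localIntersection_partner_corner, localIntersection_partner_straight,
    localIntersection_partner_straight, localIntersection_straight_self]
  generalize (w.map fun m => F m.partner * (G m * if m.isFirst then 1 else -1)).sum = S at *
  simp only [Letter.isFirst_partner, Letter.partner_partner]
  cases x.isFirst <;> cases y.isFirst <;> simp <;> linarith

/-! ### Antisymmetry -/

theorem inflow_cons_of_ne {x l : Letter} (h : x ≠ l) (w : List Letter) (a : Chain) :
    a.inflow (x :: w) l = (Chain.mk (a.base + a.jump x) a.jump).inflow w l := by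
  simp [Chain.inflow, sumBefore_cons_of_ne h, add_assoc]

theorem inflow_cons_self (x : Letter) (w : List Letter) (a : Chain) :
    a.inflow (x :: w) x = a.base := by simp [Chain.inflow]

/-- The outflow of a passage is the inflow of the next one, so the sum telescopes. -/
theorem sum_outflow_sub_inflow {w : List Letter} (hw : w.Nodup) (a b : Chain) (Φ : ℤ → ℤ → ℤ) :
    (w.map fun l => Φ (a.outflow w l) (b.outflow w l) - Φ (a.inflow w l) (b.inflow w l)).sum =
      Φ (a.base + (w.map a.jump).sum) (b.base + (w.map b.jump).sum) - Φ a.base b.base := by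
  induction w generalizing a b with
  | nil => simp
  | cons x w ih =>
    rw [List.nodup_cons] at hw
    have := ih hw.2 ⟨a.base + a.jump x, a.jump⟩ ⟨b.base + b.jump x, b.jump⟩
    rw [List.map_cons, List.sum_cons, List.map_congr_left
      (g := fun l => Φ ((Chain.mk (a.base + a.jump x) a.jump).outflow w l)
          ((Chain.mk (b.base + b.jump x) b.jump).outflow w l) -
        Φ ((Chain.mk (a.base + a.jump x) a.jump).inflow w l)
          ((Chain.mk (b.base + b.jump x) b.jump).inflow w l)), this]
    · simp [Chain.outflow, inflow_cons_self, add_assoc]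
    · intro l hl
      have : x ≠ l := fun e => hw.1 (e ▸ hl)
      simp only [Chain.outflow, inflow_cons_of_ne this]

theorem sum_jump_eq_zero {w : List Letter} (hw : IsGaussCode w) {a : Chain} (ha : a.IsCycle) :
    (w.map a.jump).sum = 0 := by
  have h := sum_map_reindex hw a.jump
  have : (w.map fun l => a.jump l.partner).sum = (w.map fun l => 0 - a.jump l).sum := by
    congr 1; apply List.map_congr_left; intro l _; rw [ha]; ring
  rw [this, sum_map_sub'] at h
  simp at h
  omega

/-- Summation by parts: by Kirchhoff's law the two contributions at a crossing combine to increments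
of the product of the multiplicities, which telescope to 0 around the knot, and to two sums that
exchanging partners identifies. -/
theorem pairing_add_pairing {w : List Letter} (hw : IsGaussCode w) {a b : Chain}
    (ha : a.IsCycle) (hb : b.IsCycle) : pairing w a b + pairing w b a = 0 := by
  have h1 : pairing w b a = (w.map fun l => pairingAt w b a l.partner).sum :=
    (sum_map_reindex hw _).symm
  have h2 := sum_outflow_sub_inflow hw.nodup a b (fun x y => x * y)
  have h3 := sum_map_reindex hw fun l => a.inflow w l.partner * b.jump l
  simp only [sum_jump_eq_zero hw ha, sum_jump_eq_zero hw hb, add_zero, sub_self] at h2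
  simp only [Letter.partner_partner, hb _] at h3
  rw [h1, pairing, ← sum_map_add']
  have : (w.map fun l => pairingAt w a b l + pairingAt w b a l.partner).sum =
      (w.map fun l => (a.inflow w l.partner * b.jump l - a.inflow w l * -b.jump l) -
        (a.outflow w l * b.outflow w l - a.inflow w l * b.inflow w l)).sum := by
    congr 1; apply List.map_congr_left; intro l _
    simp only [pairingAt, Chain.outflow, Letter.isFirst_partner, Letter.partner_partner, ha l]
    cases l.isFirst <;> simp <;> ring
  rw [this, sum_map_sub', sum_map_sub', h2, h3]
  ring

theorem pairing_comm {w : List Letter} (hw : IsGaussCode w) {a b : Chain}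
    (ha : a.IsCycle) (hb : b.IsCycle) : pairing w a b = -pairing w b a := by
  have := pairing_add_pairing hw ha hb
  linarith

theorem pairing_self {w : List Letter} (hw : IsGaussCode w) {a : Chain} (ha : a.IsCycle) :
    pairing w a a = 0 := by
  have := pairing_add_pairing hw ha ha
  linarith

theorem pairing_eq_sub_left {w : List Letter} (hw : IsGaussCode w) {a b c : Chain}
    (h : ∀ l ∈ w, a.inflow w l = b.inflow w l - c.inflow w l)
    (hj : ∀ l ∈ w, a.jump l = b.jump l - c.jump l) (d : Chain) :
    pairing w a d = pairing w b d - pairing w c d := by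
  rw [pairing, pairing, pairing, ← sum_map_sub']
  congr 1; apply List.map_congr_left; intro l hl
  have hl' := hw.partner_mem l hl
  simp only [pairingAt, Chain.outflow, h _ hl', hj _ hl']
  split <;> ring

/-- The cycles starting at the two passages of a crossing together run once through every edge of
the knot. -/
theorem inflow_loop_compl {w : List Letter} (hw : IsGaussCode w) {x : Letter} (hx : x ∈ w)
    (l : Letter) : (loop w x.partner).inflow w l = knotChain.inflow w l - (loop w x).inflow w l := by
  have h := inflow_loop_partner hw.nodup hx (hw.partner_mem x hx)
  have h' : ∀ s, sumBefore w (jumpAt x.partner) s = - sumBefore w (jumpAt x) s := by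
    intro s
    have := sum_map_sub' (w.takeWhile fun l => l ≠ s) (fun _ => 0) (jumpAt x)
    simp only [zero_sub] at this
    simp only [sumBefore, funext (jumpAt_partner_left x), this]
    simp
  rw [inflow_knotChain]
  simp only [Chain.inflow, loop, h'] at h ⊢
  linarith

theorem pairing_loop_partner_left {w : List Letter} (hw : IsGaussCode w) {x : Letter} (hx : x ∈ w)
    (b : Chain) :
    pairing w (loop w x.partner) b = pairing w knotChain b - pairing w (loop w x) b :=
  pairing_eq_sub_left hw (fun l _ => inflow_loop_compl hw hx l)
    (fun l _ => by simp [loop, knotChain, jumpAt_partner_left]) b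

/-- The intersection number of the cycle of `x` with the knot. -/
def index (w : List Letter) (x : Letter) : ℤ := pairing w (loop w x) knotChain

/-- The intersection number of the cycles of `x` and `y`. -/
def linking (w : List Letter) (x y : Letter) : ℤ := pairing w (loop w x) (loop w y)

theorem linking_comm {w : List Letter} (hw : IsGaussCode w) (x y : Letter) :
    linking w x y = -linking w y x := pairing_comm hw (loop_isCycle w x) (loop_isCycle w y)

theorem linking_self {w : List Letter} (hw : IsGaussCode w) (x : Letter) : linking w x x = 0 :=
  pairing_self hw (loop_isCycle w x)

theorem linking_partner_right {w : List Letter} (hw : IsGaussCode w) (x : Letter) {y : Letter}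
    (hy : y ∈ w) : linking w x y.partner = index w x - linking w x y := by
  rw [linking, pairing_comm hw (loop_isCycle _ _) (loop_isCycle _ _),
    pairing_loop_partner_left hw hy, index, linking,
    pairing_comm hw knotChain_isCycle (loop_isCycle _ _),
    pairing_comm hw (loop_isCycle w y) (loop_isCycle w x)]
  ring

theorem index_partner {w : List Letter} (hw : IsGaussCode w) {x : Letter} (hx : x ∈ w) :
    index w x.partner = -index w x := by
  rw [index, pairing_loop_partner_left hw hx, pairing_self hw knotChain_isCycle, index]
  ring

theorem linking_partner_partner {w : List Letter} (hw : IsGaussCode w) {x y : Letter}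
    (hx : x ∈ w) (hy : y ∈ w) :
    linking w x.partner y.partner = index w y - index w x + linking w x y := by
  rw [linking_partner_right hw _ hy, index_partner hw hx, linking_comm hw x.partner,
    linking_partner_right hw _ hx, linking_comm hw y x]
  ring

/-! ### The effect of the moves on intersection numbers -/

/-! ### Change of the base point and renaming of the crossings. -/

theorem pairing_congr {w w' : List Letter} (h : w.Perm w') {a b a' b' : Chain}
    (hw : IsGaussCode w) (ha : ∀ l ∈ w, a.inflow w l = a'.inflow w' l)
    (hb : ∀ l ∈ w, b.inflow w l = b'.inflow w' l) (ja : ∀ l ∈ w, a.jump l = a'.jump l)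
    (jb : ∀ l ∈ w, b.jump l = b'.jump l) : pairing w a b = pairing w' a' b' := by
  rw [pairing, pairing, ← (h.map _).sum_eq]
  congr 1; apply List.map_congr_left; intro l hl
  have hl' := hw.partner_mem l hl
  simp only [pairingAt, Chain.outflow, ha _ hl', hb _ hl, ja _ hl', jb _ hl]

/-- Since the jumps sum to zero, rotating the word shifts all partial sums by one constant. The base
of `loop` is minus the partial sum at `x`, so the constant cancels in the multiplicities. -/
theorem inflow_loop_rotate {u v : List Letter} (hw : IsGaussCode (u ++ v)) {x l : Letter}
    (hx : x ∈ u ++ v) (hl : l ∈ u ++ v) :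
    (loop (u ++ v) x).inflow (u ++ v) l = (loop (v ++ u) x).inflow (v ++ u) l := by
  have h0 : (u.map (jumpAt x)).sum + (v.map (jumpAt x)).sum = 0 := by
    have := sum_jump_eq_zero hw (loop_isCycle [] x)
    simpa [loop] using this
  have key : ∀ s ∈ u ++ v, sumBefore (v ++ u) (jumpAt x) s =
      sumBefore (u ++ v) (jumpAt x) s + (v.map (jumpAt x)).sum := by
    intro s hs
    have hd := hw.nodup
    rw [List.nodup_append] at hd
    by_cases h : s ∈ u
    · have h' : s ∉ v := fun h' => hd.2.2 s h s h' rfl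
      rw [sumBefore_append_of_mem h, sumBefore_append_of_notMem h']
      ring
    · have h' : s ∈ v := (List.mem_append.1 hs).resolve_left h
      rw [sumBefore_append_of_mem h', sumBefore_append_of_notMem h]
      linarith
  simp only [Chain.inflow, loop, key x hx, key l hl]
  ring

theorem linking_rotate {u v : List Letter} (hw : IsGaussCode (u ++ v)) {x y : Letter}
    (hx : x ∈ u ++ v) (hy : y ∈ u ++ v) : linking (u ++ v) x y = linking (v ++ u) x y :=
  pairing_congr List.perm_append_comm hw (fun _ h => inflow_loop_rotate hw hx h)
    (fun _ h => inflow_loop_rotate hw hy h) (fun _ _ => rfl) fun _ _ => rfl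

theorem index_rotate {u v : List Letter} (hw : IsGaussCode (u ++ v)) {x : Letter}
    (hx : x ∈ u ++ v) : index (u ++ v) x = index (v ++ u) x :=
  pairing_congr List.perm_append_comm hw (fun _ h => inflow_loop_rotate hw hx h)
    (fun _ _ => by simp) (fun _ _ => rfl) fun _ _ => rfl

/-- The letter with a new name. -/
def Letter.rename (f : ℕ → ℕ) (l : Letter) : Letter := ⟨f l.label, l.isOver, l.pos⟩

theorem Letter.rename_injective {f : ℕ → ℕ} (hf : Function.Injective f) :
    Function.Injective (Letter.rename f) := by
  rintro ⟨c, o, p⟩ ⟨c', o', p'⟩ h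
  simp only [Letter.rename, Letter.mk.injEq] at h
  rw [hf h.1, h.2.1, h.2.2]

theorem Letter.rename_partner (f : ℕ → ℕ) (l : Letter) :
    l.partner.rename f = (l.rename f).partner := rfl

theorem sumBefore_rename {f : ℕ → ℕ} (hf : Function.Injective f) (w : List Letter)
    (J : Letter → ℤ) (s : Letter) :
    sumBefore (w.map (Letter.rename f)) J (s.rename f) = sumBefore w (fun l => J (l.rename f)) s := by
  induction w with
  | nil => rfl
  | cons a w ih =>
    by_cases h : a = s
    · subst h; simp
    · rw [List.map_cons, sumBefore_cons_of_ne h,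
        sumBefore_cons_of_ne fun e => h (Letter.rename_injective hf e), ih]

theorem jumpAt_rename {f : ℕ → ℕ} (hf : Function.Injective f) (x l : Letter) :
    jumpAt (x.rename f) (l.rename f) = jumpAt x l := by
  simp only [jumpAt, ← Letter.rename_partner, (Letter.rename_injective hf).eq_iff]

theorem inflow_loop_rename {f : ℕ → ℕ} (hf : Function.Injective f) (w : List Letter)
    (x l : Letter) : (loop (w.map (Letter.rename f)) (x.rename f)).inflow
      (w.map (Letter.rename f)) (l.rename f) = (loop w x).inflow w l := by
  simp only [Chain.inflow, loop, sumBefore_rename hf, jumpAt_rename hf]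

theorem pairing_rename {f : ℕ → ℕ} {w : List Letter} {a b a' b' : Chain}
    (ha : ∀ l, a'.inflow (w.map (Letter.rename f)) (l.rename f) = a.inflow w l)
    (hb : ∀ l, b'.inflow (w.map (Letter.rename f)) (l.rename f) = b.inflow w l)
    (ja : ∀ l, a'.jump (l.rename f) = a.jump l) (jb : ∀ l, b'.jump (l.rename f) = b.jump l) :
    pairing (w.map (Letter.rename f)) a' b' = pairing w a b := by
  rw [pairing, pairing, List.map_map]
  congr 1; apply List.map_congr_left; intro l _
  simp only [Function.comp, pairingAt, Chain.outflow, ← Letter.rename_partner, ha, hb, ja, jb]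
  rfl

theorem linking_rename {f : ℕ → ℕ} (hf : Function.Injective f) (w : List Letter)
    (x y : Letter) :
    linking (w.map (Letter.rename f)) (x.rename f) (y.rename f) = linking w x y :=
  pairing_rename (inflow_loop_rename hf w x) (inflow_loop_rename hf w y) (jumpAt_rename hf x)
    (jumpAt_rename hf y)

theorem index_rename {f : ℕ → ℕ} (hf : Function.Injective f) (w : List Letter) (x : Letter) :
    index (w.map (Letter.rename f)) (x.rename f) = index w x :=
  pairing_rename (inflow_loop_rename hf w x) (by simp) (jumpAt_rename hf x) fun _ => rfl

/-! #### Segments -/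

theorem seg_perm (d d' : Bool) (x y : Letter) : (seg d x y).Perm (seg d' x y) := by
  cases d <;> cases d' <;> simp [seg, List.Perm.swap]

@[simp] theorem mem_seg {d : Bool} {x y l : Letter} : l ∈ seg d x y ↔ l = x ∨ l = y := by
  cases d <;> simp [seg, or_comm]

@[simp] theorem sum_map_seg (d : Bool) (x y : Letter) (J : Letter → ℤ) :
    ((seg d x y).map J).sum = J x + J y := by
  cases d <;> simp [seg, add_comm]

theorem sumBefore_seg_change (d d' : Bool) {x y l : Letter} (hx : l ≠ x) (hy : l ≠ y)
    (A B : List Letter) (J : Letter → ℤ) :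
    sumBefore (A ++ (seg d x y ++ B)) J l = sumBefore (A ++ (seg d' x y ++ B)) J l := by
  have hs : ∀ d, l ∉ seg d x y := fun d => by simp [hx, hy]
  by_cases h : l ∈ A
  · rw [sumBefore_append_of_mem h, sumBefore_append_of_mem h]
  · rw [sumBefore_append_of_notMem h, sumBefore_append_of_notMem h,
      sumBefore_append_of_notMem (hs d), sumBefore_append_of_notMem (hs d'), sum_map_seg,
      sum_map_seg]

theorem sumBefore_seg_left {d : Bool} {x y : Letter} (hxy : x ≠ y) {w A B : List Letter}
    (hw : w = A ++ (seg d x y ++ B)) (hx : x ∉ A) (J : Letter → ℤ) :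
    sumBefore w J x = (A.map J).sum + if d then 0 else J y := by
  rw [hw, sumBefore_append_of_notMem hx, sumBefore_append_of_mem (by simp)]
  cases d
  · simp [seg, sumBefore_cons_of_ne hxy.symm]
  · simp [seg]

theorem sumBefore_seg_right {d : Bool} {x y : Letter} (hxy : x ≠ y) {w A B : List Letter}
    (hw : w = A ++ (seg d x y ++ B)) (hy : y ∉ A) (J : Letter → ℤ) :
    sumBefore w J y = (A.map J).sum + if d then J x else 0 := by
  rw [hw, sumBefore_append_of_notMem hy, sumBefore_append_of_mem (by simp)]
  cases d
  · simp [seg]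
  · simp [seg, sumBefore_cons_of_ne hxy]

/-- A word with three marked pairs of adjacent letters. -/
def threeSegs (d₁ d₂ d₃ : Bool) (x₁ y₁ x₂ y₂ x₃ y₃ : Letter) (u v z : List Letter) :
    List Letter :=
  seg d₁ x₁ y₁ ++ u ++ seg d₂ x₂ y₂ ++ v ++ seg d₃ x₃ y₃ ++ z

section threeSegs

variable {d₁ d₂ d₃ : Bool} {x₁ y₁ x₂ y₂ x₃ y₃ : Letter} {u v z : List Letter}

theorem threeSegs_perm (d₁ d₂ d₃ d₁' d₂' d₃' : Bool) (x₁ y₁ x₂ y₂ x₃ y₃ : Letter)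
    (u v z : List Letter) : (threeSegs d₁ d₂ d₃ x₁ y₁ x₂ y₂ x₃ y₃ u v z).Perm
      (threeSegs d₁' d₂' d₃' x₁ y₁ x₂ y₂ x₃ y₃ u v z) :=
  (((((seg_perm d₁ d₁' x₁ y₁).append_right u).append (seg_perm d₂ d₂' x₂ y₂)).append_right v).append
    (seg_perm d₃ d₃' x₃ y₃)).append_right z

theorem threeSegs_nodup (h : (threeSegs d₁ d₂ d₃ x₁ y₁ x₂ y₂ x₃ y₃ u v z).Nodup) :
    [x₁, y₁, x₂, y₂, x₃, y₃].Nodup ∧ (∀ l ∈ u ++ (v ++ z), l ∉ [x₁, y₁, x₂, y₂, x₃, y₃]) := by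
  rw [(threeSegs_perm d₁ d₂ d₃ true true true _ _ _ _ _ _ u v z).nodup_iff] at h
  simp only [threeSegs, seg, if_true, List.nodup_append, List.mem_append, List.mem_cons,
    List.nodup_cons] at h ⊢
  grind

theorem sumBefore_threeSegs_of_notMem (d₁ d₂ d₃ d₁' d₂' d₃' : Bool) {l : Letter}
    (h : l ∉ [x₁, y₁, x₂, y₂, x₃, y₃]) (J : Letter → ℤ) :
    sumBefore (threeSegs d₁ d₂ d₃ x₁ y₁ x₂ y₂ x₃ y₃ u v z) J l =
      sumBefore (threeSegs d₁' d₂' d₃' x₁ y₁ x₂ y₂ x₃ y₃ u v z) J l := by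
  simp only [List.mem_cons, not_or] at h
  have e1 := sumBefore_seg_change d₁ d₁' h.1 h.2.1 []
    (u ++ (seg d₂ x₂ y₂ ++ (v ++ (seg d₃ x₃ y₃ ++ z)))) J
  have e2 := sumBefore_seg_change d₂ d₂' h.2.2.1 h.2.2.2.1 (seg d₁' x₁ y₁ ++ u)
    (v ++ (seg d₃ x₃ y₃ ++ z)) J
  have e3 := sumBefore_seg_change d₃ d₃' h.2.2.2.2.1 h.2.2.2.2.2.1
    (seg d₁' x₁ y₁ ++ (u ++ (seg d₂' x₂ y₂ ++ v))) z J
  simp only [threeSegs, List.nil_append, List.append_assoc] at *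
  rw [e1, e2, e3]

/-- The partial sums at the six letters of the segments. -/
theorem sumBefore_threeSegs (h : (threeSegs d₁ d₂ d₃ x₁ y₁ x₂ y₂ x₃ y₃ u v z).Nodup)
    (J : Letter → ℤ) :
    let w := threeSegs d₁ d₂ d₃ x₁ y₁ x₂ y₂ x₃ y₃ u v z
    let Y := J x₁ + J y₁ + (u.map J).sum
    let Z := J x₁ + J y₁ + (u.map J).sum + (J x₂ + J y₂) + (v.map J).sum
    sumBefore w J x₁ = (if d₁ then 0 else J y₁) ∧ sumBefore w J y₁ = (if d₁ then J x₁ else 0) ∧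
      sumBefore w J x₂ = Y + (if d₂ then 0 else J y₂) ∧
      sumBefore w J y₂ = Y + (if d₂ then J x₂ else 0) ∧
      sumBefore w J x₃ = Z + (if d₃ then 0 else J y₃) ∧
      sumBefore w J y₃ = Z + (if d₃ then J x₃ else 0) := by
  obtain ⟨hn, hr⟩ := threeSegs_nodup h
  have hu : ∀ l ∈ [x₁, y₁, x₂, y₂, x₃, y₃], l ∉ u := fun l hl h => hr l (by simp [h]) hl
  have hv : ∀ l ∈ [x₁, y₁, x₂, y₂, x₃, y₃], l ∉ v := fun l hl h => hr l (by simp [h]) hl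
  simp only [List.nodup_cons, List.mem_cons, not_or] at hn
  have w1 : threeSegs d₁ d₂ d₃ x₁ y₁ x₂ y₂ x₃ y₃ u v z =
    [] ++ (seg d₁ x₁ y₁ ++ (u ++ seg d₂ x₂ y₂ ++ v ++ seg d₃ x₃ y₃ ++ z)) := by simp [threeSegs]
  have w2 : threeSegs d₁ d₂ d₃ x₁ y₁ x₂ y₂ x₃ y₃ u v z =
    seg d₁ x₁ y₁ ++ u ++ (seg d₂ x₂ y₂ ++ (v ++ seg d₃ x₃ y₃ ++ z)) := by simp [threeSegs]
  have w3 : threeSegs d₁ d₂ d₃ x₁ y₁ x₂ y₂ x₃ y₃ u v z =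
    seg d₁ x₁ y₁ ++ u ++ seg d₂ x₂ y₂ ++ v ++ (seg d₃ x₃ y₃ ++ z) := by simp [threeSegs]
  intro w Y Z
  have hx₂ := hu x₂ (by simp)
  have hy₂ := hu y₂ (by simp)
  have hx₃ := hu x₃ (by simp)
  have hy₃ := hu y₃ (by simp)
  have hx₃' := hv x₃ (by simp)
  have hy₃' := hv y₃ (by simp)
  refine ⟨?_, ?_, ?_, ?_, ?_, ?_⟩
  · rw [sumBefore_seg_left (by grind) w1 (by simp)]; simp
  · rw [sumBefore_seg_right (by grind) w1 (by simp)]; simp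
  · rw [sumBefore_seg_left (by grind) w2 (by simp; grind)]; simp [Y]
  · rw [sumBefore_seg_right (by grind) w2 (by simp; grind)]; simp [Y]
  · rw [sumBefore_seg_left (by grind) w3 (by simp; grind)]; simp [Z]; ring
  · rw [sumBefore_seg_right (by grind) w3 (by simp; grind)]; simp [Z]; ring

/-- As adjacent passages of a segment belong to different crossings, reversing the segments does
not change the base of a cycle. -/
theorem loop_threeSegs (d₁' d₂' d₃' : Bool)
    (h : (threeSegs d₁ d₂ d₃ x₁ y₁ x₂ y₂ x₃ y₃ u v z).Nodup)
    (h₁ : x₁.label ≠ y₁.label) (h₂ : x₂.label ≠ y₂.label) (h₃ : x₃.label ≠ y₃.label) (x : Letter) :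
    loop (threeSegs d₁ d₂ d₃ x₁ y₁ x₂ y₂ x₃ y₃ u v z) x =
      loop (threeSegs d₁' d₂' d₃' x₁ y₁ x₂ y₂ x₃ y₃ u v z) x := by
  have h' := (threeSegs_perm d₁ d₂ d₃ d₁' d₂' d₃' x₁ y₁ x₂ y₂ x₃ y₃ u v z).nodup_iff.1 h
  have hz : ∀ {x y : Letter}, x.label ≠ y.label → jumpAt x y = 0 ∧ jumpAt y x = 0 := by
    intro x y hxy
    constructor
    · exact jumpAt_of_ne (fun e => hxy (e ▸ rfl)) (fun e => hxy (e ▸ rfl))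
    · exact jumpAt_of_ne (fun e => hxy (e ▸ rfl)) (fun e => hxy (e ▸ rfl))
  rw [loop, loop]
  congr 2
  by_cases hx : x ∈ [x₁, y₁, x₂, y₂, x₃, y₃]
  · obtain ⟨e1, e2, e3, e4, e5, e6⟩ := sumBefore_threeSegs h (jumpAt x)
    obtain ⟨f1, f2, f3, f4, f5, f6⟩ := sumBefore_threeSegs h' (jumpAt x)
    simp only [List.mem_cons, List.not_mem_nil, or_false] at hx
    rcases hx with rfl | rfl | rfl | rfl | rfl | rfl
    · rw [e1, f1, (hz h₁).1]; simp
    · rw [e2, f2, (hz h₁).2]; simp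
    · rw [e3, f3, (hz h₂).1]; simp
    · rw [e4, f4, (hz h₂).2]; simp
    · rw [e5, f5, (hz h₃).1]; simp
    · rw [e6, f6, (hz h₃).2]; simp
  · exact sumBefore_threeSegs_of_notMem _ _ _ _ _ _ hx _

/-- Reversing a segment keeps its total jump, so partial sums, and hence contributions, change only
at the six passages of the segments; the third move is thereby reduced to the identity `hs`. -/
theorem pairing_threeSegs (d₁' d₂' d₃' : Bool)
    (hp : ∀ l ∈ u ++ (v ++ z), l ∉ [x₁, y₁, x₂, y₂, x₃, y₃] ∧
      l.partner ∉ [x₁, y₁, x₂, y₂, x₃, y₃]) (a b : Chain)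
    (hs : let φ := pairingAt (threeSegs d₁ d₂ d₃ x₁ y₁ x₂ y₂ x₃ y₃ u v z) a b
      let φ' := pairingAt (threeSegs d₁' d₂' d₃' x₁ y₁ x₂ y₂ x₃ y₃ u v z) a b
      φ x₁ + φ y₁ + (φ x₂ + φ y₂) + (φ x₃ + φ y₃) =
        φ' x₁ + φ' y₁ + (φ' x₂ + φ' y₂) + (φ' x₃ + φ' y₃)) :
    pairing (threeSegs d₁ d₂ d₃ x₁ y₁ x₂ y₂ x₃ y₃ u v z) a b =
      pairing (threeSegs d₁' d₂' d₃' x₁ y₁ x₂ y₂ x₃ y₃ u v z) a b := by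
  set w := threeSegs d₁ d₂ d₃ x₁ y₁ x₂ y₂ x₃ y₃ u v z with hw
  set w' := threeSegs d₁' d₂' d₃' x₁ y₁ x₂ y₂ x₃ y₃ u v z with hw'
  have key : ∀ l ∈ u ++ (v ++ z), pairingAt w a b l = pairingAt w' a b l := by
    intro l hl
    obtain ⟨h1, h2⟩ := hp l hl
    simp only [pairingAt, Chain.outflow, Chain.inflow, hw, hw',
      sumBefore_threeSegs_of_notMem d₁ d₂ d₃ d₁' d₂' d₃' h1,
      sumBefore_threeSegs_of_notMem d₁ d₂ d₃ d₁' d₂' d₃' h2]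
  have ku := List.map_congr_left (l := u) fun l hl => key l (by simp [hl])
  have kv := List.map_congr_left (l := v) fun l hl => key l (by simp [hl])
  have kz := List.map_congr_left (l := z) fun l hl => key l (by simp [hl])
  have hsum : ∀ (d₁ d₂ d₃ : Bool) (φ : Letter → ℤ),
      ((threeSegs d₁ d₂ d₃ x₁ y₁ x₂ y₂ x₃ y₃ u v z).map φ).sum =
      (φ x₁ + φ y₁ + (φ x₂ + φ y₂) + (φ x₃ + φ y₃)) + ((u.map φ).sum + (v.map φ).sum +
        (z.map φ).sum) := by
    intro d₁ d₂ d₃ φ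
    simp only [threeSegs, List.map_append, List.sum_append, sum_map_seg]
    ring
  rw [pairing, pairing]
  conv_lhs => rw [hw, hsum, ← hw]
  conv_rhs => rw [hw', hsum, ← hw']
  rw [hs, ku, kv, kz]

end threeSegs

theorem linking_eq_and_index_eq_of_pairing {w w' : List Letter} (hl : ∀ x, loop w x = loop w' x)
    (hp : ∀ a b : Chain, a.IsCycle → b.IsCycle → pairing w a b = pairing w' a b) (x y : Letter) :
    linking w x y = linking w' x y ∧ index w x = index w' x := by
  rw [linking, linking, index, index, ← hl, ← hl,
    hp _ _ (loop_isCycle _ _) (loop_isCycle _ _), hp _ _ (loop_isCycle _ _) knotChain_isCycle]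
  exact ⟨rfl, rfl⟩

theorem IsGaussCode.label_ne {w : List Letter} (hw : IsGaussCode w) {x y : Letter} (hx : x ∈ w)
    (hy : y ∈ w) (h : x ≠ y) (h' : x.isOver = y.isOver) : x.label ≠ y.label := fun e =>
  h (by ext1; exacts [e, h', hw.pos_eq _ hx _ hy e])

/-- The third move preserves intersection numbers: order of the strands top, middle, bottom. -/
theorem pairing_r3 (a b c : ℕ) (κ t m e : Bool) (u v z : List Letter)
    (hw : IsGaussCode (threeSegs t m e ⟨a, true, triSign κ t m⟩ ⟨b, true, triSign κ t e⟩
      ⟨a, false, triSign κ t m⟩ ⟨c, true, triSign κ m e⟩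
      ⟨b, false, triSign κ t e⟩ ⟨c, false, triSign κ m e⟩ u v z)) (x y : Letter) :
    linking (threeSegs t m e ⟨a, true, triSign κ t m⟩ ⟨b, true, triSign κ t e⟩
      ⟨a, false, triSign κ t m⟩ ⟨c, true, triSign κ m e⟩
      ⟨b, false, triSign κ t e⟩ ⟨c, false, triSign κ m e⟩ u v z) x y =
    linking (threeSegs (!t) (!m) (!e) ⟨a, true, triSign κ t m⟩ ⟨b, true, triSign κ t e⟩
      ⟨a, false, triSign κ t m⟩ ⟨c, true, triSign κ m e⟩
      ⟨b, false, triSign κ t e⟩ ⟨c, false, triSign κ m e⟩ u v z) x y ∧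
    index (threeSegs t m e ⟨a, true, triSign κ t m⟩ ⟨b, true, triSign κ t e⟩
      ⟨a, false, triSign κ t m⟩ ⟨c, true, triSign κ m e⟩
      ⟨b, false, triSign κ t e⟩ ⟨c, false, triSign κ m e⟩ u v z) x =
    index (threeSegs (!t) (!m) (!e) ⟨a, true, triSign κ t m⟩ ⟨b, true, triSign κ t e⟩
      ⟨a, false, triSign κ t m⟩ ⟨c, true, triSign κ m e⟩
      ⟨b, false, triSign κ t e⟩ ⟨c, false, triSign κ m e⟩ u v z) x := by
  obtain ⟨hn, hr⟩ := threeSegs_nodup hw.nodup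
  have hab : a ≠ b := hw.label_ne (x := ⟨a, true, triSign κ t m⟩) (y := ⟨b, true, triSign κ t e⟩)
    (by simp [threeSegs]) (by simp [threeSegs]) (by grind) rfl
  have hac : a ≠ c := hw.label_ne (x := ⟨a, true, triSign κ t m⟩) (y := ⟨c, true, triSign κ m e⟩)
    (by simp [threeSegs]) (by simp [threeSegs]) (by grind) rfl
  have hbc : b ≠ c := hw.label_ne (x := ⟨b, true, triSign κ t e⟩) (y := ⟨c, true, triSign κ m e⟩)
    (by simp [threeSegs]) (by simp [threeSegs]) (by grind) rfl
  apply linking_eq_and_index_eq_of_pairing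
  · exact loop_threeSegs _ _ _ hw.nodup hab hac hbc
  intro α β hα hβ
  apply pairing_threeSegs
  · intro l hl
    refine ⟨hr l hl, fun h => hr l hl ?_⟩
    simp only [List.mem_cons, List.not_mem_nil, or_false, Letter.partner_eq_comm] at h ⊢
    simp only [Letter.partner, Bool.not_true, Bool.not_false] at h
    tauto
  · have h' := (threeSegs_perm t m e (!t) (!m) (!e) _ _ _ _ _ _ u v z).nodup_iff.1 hw.nodup
    obtain ⟨e1, e2, e3, e4, e5, e6⟩ := sumBefore_threeSegs hw.nodup α.jump
    obtain ⟨f1, f2, f3, f4, f5, f6⟩ := sumBefore_threeSegs h' α.jump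
    obtain ⟨g1, g2, g3, g4, g5, g6⟩ := sumBefore_threeSegs hw.nodup β.jump
    obtain ⟨k1, k2, k3, k4, k5, k6⟩ := sumBefore_threeSegs h' β.jump
    -- Kirchhoff's law expresses the jumps at the under-passages by those at the over-passages. What
    -- remains is, for each of the sixteen orientations, a polynomial identity in the bases, the
    -- jumps at the three crossings and the total jumps along `u` and `v`.
    have a1 := hα ⟨a, true, triSign κ t m⟩
    have a2 := hα ⟨b, true, triSign κ t e⟩
    have a3 := hα ⟨c, true, triSign κ m e⟩
    have b1 := hβ ⟨a, true, triSign κ t m⟩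
    have b2 := hβ ⟨b, true, triSign κ t e⟩
    have b3 := hβ ⟨c, true, triSign κ m e⟩
    simp only [pairingAt, Chain.outflow, Chain.inflow, Letter.partner, Bool.not_true,
      Bool.not_false] at a1 a2 a3 b1 b2 b3 ⊢
    simp only [e1, e2, e3, e4, e5, e6, f1, f2, f3, f4, f5, f6, g1, g2, g3, g4, g5, g6,
      k1, k2, k3, k4, k5, k6, a1, a2, a3, b1, b2, b3]
    cases κ <;> cases t <;> cases m <;> cases e <;>
      simp only [triSign, Letter.isFirst, Bool.xor_false, Bool.xor_true, Bool.not_true,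
        Bool.not_false, beq_self_eq_true, Bool.true_beq, Bool.false_beq, if_true, if_false,
        Bool.false_eq_true] <;> ring

/-- The third move preserves intersection numbers: order of the strands top, bottom, middle. -/
theorem pairing_r3' (a b c : ℕ) (κ t m e : Bool) (u v z : List Letter)
    (hw : IsGaussCode (threeSegs t e m ⟨a, true, triSign κ t m⟩ ⟨b, true, triSign κ t e⟩
      ⟨b, false, triSign κ t e⟩ ⟨c, false, triSign κ m e⟩
      ⟨a, false, triSign κ t m⟩ ⟨c, true, triSign κ m e⟩ u v z)) (x y : Letter) :
    linking (threeSegs t e m ⟨a, true, triSign κ t m⟩ ⟨b, true, triSign κ t e⟩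
      ⟨b, false, triSign κ t e⟩ ⟨c, false, triSign κ m e⟩
      ⟨a, false, triSign κ t m⟩ ⟨c, true, triSign κ m e⟩ u v z) x y =
    linking (threeSegs (!t) (!e) (!m) ⟨a, true, triSign κ t m⟩ ⟨b, true, triSign κ t e⟩
      ⟨b, false, triSign κ t e⟩ ⟨c, false, triSign κ m e⟩
      ⟨a, false, triSign κ t m⟩ ⟨c, true, triSign κ m e⟩ u v z) x y ∧
    index (threeSegs t e m ⟨a, true, triSign κ t m⟩ ⟨b, true, triSign κ t e⟩
      ⟨b, false, triSign κ t e⟩ ⟨c, false, triSign κ m e⟩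
      ⟨a, false, triSign κ t m⟩ ⟨c, true, triSign κ m e⟩ u v z) x =
    index (threeSegs (!t) (!e) (!m) ⟨a, true, triSign κ t m⟩ ⟨b, true, triSign κ t e⟩
      ⟨b, false, triSign κ t e⟩ ⟨c, false, triSign κ m e⟩
      ⟨a, false, triSign κ t m⟩ ⟨c, true, triSign κ m e⟩ u v z) x := by
  obtain ⟨hn, hr⟩ := threeSegs_nodup hw.nodup
  have hab : a ≠ b := hw.label_ne (x := ⟨a, true, triSign κ t m⟩) (y := ⟨b, true, triSign κ t e⟩)
    (by simp [threeSegs]) (by simp [threeSegs]) (by grind) rfl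
  have hac : a ≠ c := hw.label_ne (x := ⟨a, true, triSign κ t m⟩) (y := ⟨c, true, triSign κ m e⟩)
    (by simp [threeSegs]) (by simp [threeSegs]) (by grind) rfl
  have hbc : b ≠ c := hw.label_ne (x := ⟨b, true, triSign κ t e⟩) (y := ⟨c, true, triSign κ m e⟩)
    (by simp [threeSegs]) (by simp [threeSegs]) (by grind) rfl
  apply linking_eq_and_index_eq_of_pairing
  · exact loop_threeSegs _ _ _ hw.nodup hab hbc hac
  intro α β hα hβ
  apply pairing_threeSegs
  · intro l hl
    refine ⟨hr l hl, fun h => hr l hl ?_⟩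
    simp only [List.mem_cons, List.not_mem_nil, or_false, Letter.partner_eq_comm] at h ⊢
    simp only [Letter.partner, Bool.not_true, Bool.not_false] at h
    tauto
  · have h' := (threeSegs_perm t e m (!t) (!e) (!m) _ _ _ _ _ _ u v z).nodup_iff.1 hw.nodup
    obtain ⟨e1, e2, e3, e4, e5, e6⟩ := sumBefore_threeSegs hw.nodup α.jump
    obtain ⟨f1, f2, f3, f4, f5, f6⟩ := sumBefore_threeSegs h' α.jump
    obtain ⟨g1, g2, g3, g4, g5, g6⟩ := sumBefore_threeSegs hw.nodup β.jump
    obtain ⟨k1, k2, k3, k4, k5, k6⟩ := sumBefore_threeSegs h' β.jump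
    have a1 := hα ⟨a, true, triSign κ t m⟩
    have a2 := hα ⟨b, true, triSign κ t e⟩
    have a3 := hα ⟨c, true, triSign κ m e⟩
    have b1 := hβ ⟨a, true, triSign κ t m⟩
    have b2 := hβ ⟨b, true, triSign κ t e⟩
    have b3 := hβ ⟨c, true, triSign κ m e⟩
    simp only [pairingAt, Chain.outflow, Chain.inflow, Letter.partner, Bool.not_true,
      Bool.not_false] at a1 a2 a3 b1 b2 b3 ⊢
    simp only [e1, e2, e3, e4, e5, e6, f1, f2, f3, f4, f5, f6, g1, g2, g3, g4, g5, g6,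
      k1, k2, k3, k4, k5, k6, a1, a2, a3, b1, b2, b3]
    cases κ <;> cases t <;> cases m <;> cases e <;>
      simp only [triSign, Letter.isFirst, Bool.xor_false, Bool.xor_true, Bool.not_true,
        Bool.not_false, beq_self_eq_true, Bool.true_beq, Bool.false_beq, if_true, if_false,
        Bool.false_eq_true] <;> ring

/-! #### The first move -/

section FirstMove

variable {x : Letter} {w : List Letter}

theorem notMem_of_isGaussCode_cons_partner (hw : IsGaussCode (x :: x.partner :: w)) {l : Letter}
    (hl : l ∈ w) : x ≠ l ∧ x.partner ≠ l := by
  have := hw.nodup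
  simp only [List.nodup_cons, List.mem_cons, not_or] at this
  exact ⟨fun e => this.1.2 (e ▸ hl), fun e => this.2.1 (e ▸ hl)⟩

theorem inflow_cons_partner (hw : IsGaussCode (x :: x.partner :: w)) {a : Chain} (ha : a.IsCycle)
    {l : Letter} (hl : l ∈ w) : a.inflow (x :: x.partner :: w) l = a.inflow w l := by
  obtain ⟨h, h'⟩ := notMem_of_isGaussCode_cons_partner hw hl
  rw [inflow_cons_of_ne h, inflow_cons_of_ne h']
  simp [Chain.inflow, ha x]

theorem partner_mem_of_cons_partner (hw : IsGaussCode (x :: x.partner :: w)) {l : Letter}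
    (hl : l ∈ w) : l.partner ∈ w := by
  obtain ⟨h, h'⟩ := notMem_of_isGaussCode_cons_partner hw hl
  have := hw.partner_mem l (by simp [hl])
  simp only [List.mem_cons, Letter.partner_inj] at this
  rcases this with e | e | e
  · exact absurd (by rw [← e, Letter.partner_partner]) h'
  · exact absurd e.symm h
  · exact e

/-- The jumps at the two ends of an isolated chord cancel, so multiplicities elsewhere are
unchanged, and the two contributions at its crossing are opposite to each other. -/
theorem pairing_cons_partner (hw : IsGaussCode (x :: x.partner :: w)) {a b : Chain}
    (ha : a.IsCycle) (hb : b.IsCycle) :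
    pairing (x :: x.partner :: w) a b = pairing w a b := by
  have key : ∀ l ∈ w, pairingAt (x :: x.partner :: w) a b l = pairingAt w a b l := by
    intro l hl
    simp only [pairingAt, Chain.outflow, inflow_cons_partner hw ha (partner_mem_of_cons_partner hw hl),
      inflow_cons_partner hw hb hl]
  rw [pairing, List.map_cons, List.map_cons, List.map_congr_left key]
  simp only [List.sum_cons, pairingAt, Chain.outflow, Letter.partner_partner,
    inflow_cons_of_ne x.ne_partner, inflow_cons_self, Letter.isFirst_partner, ha x, hb x]
  change _ + (_ + pairing w a b) = _
  cases x.isFirst <;> simp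

theorem loop_cons_partner (hw : IsGaussCode (x :: x.partner :: w)) {y : Letter} (hy : y ∈ w) :
    loop (x :: x.partner :: w) y = loop w y := by
  obtain ⟨h, h'⟩ := notMem_of_isGaussCode_cons_partner hw hy
  have := loop_isCycle w y x
  simp only [loop] at this
  rw [loop, sumBefore_cons_of_ne h, sumBefore_cons_of_ne h', this]
  simp [loop]

/-- This cycle consists of the edge of the kink only; after the removal of the kink its multiplicity
is zero everywhere. -/
theorem pairing_loop_cons_partner (hw : IsGaussCode (x :: x.partner :: w)) {b : Chain}
    (hb : b.IsCycle) : pairing (x :: x.partner :: w) (loop (x :: x.partner :: w) x) b = 0 := by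
  rw [pairing_cons_partner hw (loop_isCycle _ _) hb, pairing]
  apply List.sum_eq_zero
  intro t ht
  obtain ⟨l, hl, rfl⟩ := List.mem_map.1 ht
  have hl' := partner_mem_of_cons_partner hw hl
  have hx : x ∉ w := fun h => (notMem_of_isGaussCode_cons_partner hw h).1 rfl
  have hx' : x.partner ∉ w := fun h => (notMem_of_isGaussCode_cons_partner hw h).2 rfl
  have h0 : (loop (x :: x.partner :: w) x).inflow w l.partner = 0 := by
    simp [Chain.inflow, loop, sumBefore_jumpAt_of_notMem hx hx']
  have h1 : (loop (x :: x.partner :: w) x).jump l.partner = 0 :=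
    jumpAt_of_ne (fun e => hx (e ▸ hl')) (fun e => hx' (e ▸ hl'))
  simp [pairingAt, Chain.outflow, h0, h1]

theorem linking_cons_partner (hw : IsGaussCode (x :: x.partner :: w)) {y z : Letter} (hy : y ∈ w)
    (hz : z ∈ w) : linking (x :: x.partner :: w) y z = linking w y z := by
  rw [linking, loop_cons_partner hw hy, loop_cons_partner hw hz,
    pairing_cons_partner hw (loop_isCycle _ _) (loop_isCycle _ _), linking]

theorem index_cons_partner (hw : IsGaussCode (x :: x.partner :: w)) {y : Letter} (hy : y ∈ w) :
    index (x :: x.partner :: w) y = index w y := by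
  rw [index, loop_cons_partner hw hy,
    pairing_cons_partner hw (loop_isCycle _ _) knotChain_isCycle, index]

end FirstMove

/-! #### The second move -/

section SecondMove

variable {a b : Letter} {d : Bool} {u v : List Letter}

/-- A word with the four passages of a second move. -/
def twoSegs (d : Bool) (a b : Letter) (u v : List Letter) : List Letter :=
  seg true a b ++ u ++ seg d a.partner b.partner ++ v

theorem twoSegs_nodup (h : (twoSegs d a b u v).Nodup) :
    [a, b, a.partner, b.partner].Nodup ∧ (∀ l ∈ u ++ v, l ∉ [a, b, a.partner, b.partner]) ∧
      (u ++ v).Nodup := by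
  cases d <;> simp only [twoSegs, seg, if_true, List.nodup_append, List.mem_append, List.mem_cons,
    List.nodup_cons, if_false, Bool.false_eq_true] at h ⊢ <;> grind

theorem sumBefore_twoSegs_of_mem (h : (twoSegs d a b u v).Nodup) {l : Letter} (hl : l ∈ u ++ v)
    {J : Letter → ℤ} (hJ : J a + J b = 0) (hJ' : J a.partner + J b.partner = 0) :
    sumBefore (twoSegs d a b u v) J l = sumBefore (u ++ v) J l := by
  have hn := (twoSegs_nodup h).2.1 l hl
  simp only [List.mem_cons, List.not_mem_nil, or_false, not_or] at hn
  have h1 : l ∉ seg true a b := by simp [hn]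
  have h2 : l ∉ seg d a.partner b.partner := by simp [hn]
  rw [twoSegs, List.append_assoc, List.append_assoc, sumBefore_append_of_notMem h1, sum_map_seg, hJ]
  by_cases hu : l ∈ u
  · rw [sumBefore_append_of_mem hu, sumBefore_append_of_mem hu, zero_add]
  · rw [sumBefore_append_of_notMem hu, sumBefore_append_of_notMem hu,
      sumBefore_append_of_notMem h2, sum_map_seg, hJ']
    ring

theorem sumBefore_twoSegs (h : (twoSegs d a b u v).Nodup) (J : Letter → ℤ) :
    let w := twoSegs d a b u v
    let Y := J a + J b + (u.map J).sum
    sumBefore w J a = 0 ∧ sumBefore w J b = J a ∧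
      sumBefore w J a.partner = Y + (if d then 0 else J b.partner) ∧
      sumBefore w J b.partner = Y + (if d then J a.partner else 0) := by
  obtain ⟨hn, hr, -⟩ := twoSegs_nodup h
  have hu : ∀ l ∈ [a, b, a.partner, b.partner], l ∉ u := fun l hl h => hr l (by simp [h]) hl
  have ha' := hu a.partner (by simp)
  have hb' := hu b.partner (by simp)
  simp only [List.nodup_cons, List.mem_cons, not_or] at hn
  have w1 : twoSegs d a b u v =
    [] ++ (seg true a b ++ (u ++ seg d a.partner b.partner ++ v)) := by simp [twoSegs]
  have w2 : twoSegs d a b u v =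
    seg true a b ++ u ++ (seg d a.partner b.partner ++ v) := by simp [twoSegs]
  intro w Y
  refine ⟨?_, ?_, ?_, ?_⟩
  · rw [sumBefore_seg_left (by grind) w1 (by simp)]; simp
  · rw [sumBefore_seg_right (by grind) w1 (by simp)]; simp
  · rw [sumBefore_seg_left (by grind) w2 (by simp; grind)]; simp [Y]
  · rw [sumBefore_seg_right (by grind) w2 (by simp; grind)]; simp [Y]

theorem partner_mem_of_twoSegs (hw : IsGaussCode (twoSegs d a b u v)) {l : Letter}
    (hl : l ∈ u ++ v) : l.partner ∈ u ++ v := by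
  have hn := (twoSegs_nodup hw.nodup).2.1 l hl
  have hm := List.mem_append.1 hl
  have := hw.partner_mem l (by simp only [twoSegs, List.mem_append]; tauto)
  simp only [twoSegs, List.mem_append, mem_seg, Letter.partner_inj] at this
  simp only [List.mem_cons, List.not_mem_nil, or_false, not_or] at hn
  have h1 : l.partner ≠ a := fun e => hn.2.2.1 (by rw [← e, Letter.partner_partner])
  have h2 : l.partner ≠ b := fun e => hn.2.2.2 (by rw [← e, Letter.partner_partner])
  rw [List.mem_append]
  tauto

theorem sum_map_twoSegs (φ : Letter → ℤ) : ((twoSegs d a b u v).map φ).sum =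
    (φ a + φ b + φ a.partner + φ b.partner) + ((u ++ v).map φ).sum := by
  simp only [twoSegs, List.map_append, List.sum_append, sum_map_seg]
  ring

/-- Chains without jumps at `a` and `b` have the same multiplicities on the strands at both
crossings, and the signs of the crossings are opposite, so the two contributions cancel. -/
theorem pairing_twoSegs (hw : IsGaussCode (twoSegs d a b u v)) (hab : b.isFirst = !a.isFirst)
    {α β : Chain} (hα : α.IsCycle) (hβ : β.IsCycle)
    (ha : α.jump a = 0) (hb : α.jump b = 0) (ha' : β.jump a = 0) (hb' : β.jump b = 0) :
    pairing (twoSegs d a b u v) α β = pairing (u ++ v) α β := by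
  have key : ∀ l ∈ u ++ v, pairingAt (twoSegs d a b u v) α β l = pairingAt (u ++ v) α β l := by
    intro l hl
    have hl' := partner_mem_of_twoSegs hw hl
    simp only [pairingAt, Chain.outflow, Chain.inflow]
    rw [sumBefore_twoSegs_of_mem hw.nodup hl (J := β.jump) (by simp [ha', hb'])
        (by simp [hβ _, ha', hb']),
      sumBefore_twoSegs_of_mem hw.nodup hl' (J := α.jump) (by simp [ha, hb])
        (by simp [hα _, ha, hb])]
  obtain ⟨e1, e2, e3, e4⟩ := sumBefore_twoSegs hw.nodup α.jump
  obtain ⟨f1, f2, f3, f4⟩ := sumBefore_twoSegs hw.nodup β.jump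
  rw [pairing, sum_map_twoSegs, List.map_congr_left key, pairing]
  simp only [pairingAt, Chain.outflow, Chain.inflow, Letter.partner_partner,
    Letter.isFirst_partner, hab, e1, e2, e3, e4, f1, f2, f3, f4, hα a, hα b, hβ a, hβ b,
    ha, hb, ha', hb']
  cases a.isFirst <;> simp

theorem loop_twoSegs (hw : IsGaussCode (twoSegs d a b u v)) {y : Letter} (hy : y ∈ u ++ v) :
    loop (twoSegs d a b u v) y = loop (u ++ v) y ∧ jumpAt y a = 0 ∧ jumpAt y b = 0 := by
  have hn := (twoSegs_nodup hw.nodup).2.1 y hy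
  simp only [List.mem_cons, List.not_mem_nil, or_false, not_or] at hn
  have h1 : jumpAt y a = 0 := jumpAt_of_ne (Ne.symm hn.1)
    fun e => hn.2.2.1 (by rw [e, Letter.partner_partner])
  have h2 : jumpAt y b = 0 := jumpAt_of_ne (Ne.symm hn.2.1)
    fun e => hn.2.2.2 (by rw [e, Letter.partner_partner])
  have h3 := loop_isCycle (u ++ v) y a
  have h4 := loop_isCycle (u ++ v) y b
  simp only [loop] at h3 h4
  refine ⟨?_, h1, h2⟩
  rw [loop, sumBefore_twoSegs_of_mem hw.nodup hy (by simp [h1, h2]) (by simp [h1, h2, h3, h4]), loop]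

theorem linking_twoSegs (hw : IsGaussCode (twoSegs d a b u v)) (hab : b.isFirst = !a.isFirst)
    {y z : Letter} (hy : y ∈ u ++ v) (hz : z ∈ u ++ v) :
    linking (twoSegs d a b u v) y z = linking (u ++ v) y z := by
  obtain ⟨e, h1, h2⟩ := loop_twoSegs hw hy
  obtain ⟨e', h1', h2'⟩ := loop_twoSegs hw hz
  rw [linking, e, e', pairing_twoSegs hw hab (loop_isCycle _ _) (loop_isCycle _ _) h1 h2 h1' h2',
    linking]

theorem index_twoSegs (hw : IsGaussCode (twoSegs d a b u v)) (hab : b.isFirst = !a.isFirst)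
    {y : Letter} (hy : y ∈ u ++ v) : index (twoSegs d a b u v) y = index (u ++ v) y := by
  obtain ⟨e, h1, h2⟩ := loop_twoSegs hw hy
  rw [index, e, pairing_twoSegs hw hab (loop_isCycle _ _) knotChain_isCycle h1 h2 rfl rfl, index]

/-- The cycles at the two crossings of a second move are homologous. -/
theorem pairing_loop_twoSegs (hw : IsGaussCode (twoSegs d a b u v)) (hab : b.isFirst = !a.isFirst)
    (hl : a.label ≠ b.label) {β : Chain} (hβ : β.IsCycle) :
    pairing (twoSegs d a b u v) (loop (twoSegs d a b u v) a) β =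
      pairing (twoSegs d a b u v) (loop (twoSegs d a b u v) b) β := by
  have hz : ∀ {x y : Letter}, x.label ≠ y.label → jumpAt x y = 0 := fun hxy =>
    jumpAt_of_ne (fun e => hxy (e ▸ rfl)) (fun e => hxy (e ▸ rfl))
  have hba : jumpAt a b = 0 := hz hl
  have hba' : jumpAt b a = 0 := hz hl.symm
  have hba'' : jumpAt a b.partner = 0 := hz (y := b.partner) hl
  have hba''' : jumpAt b a.partner = 0 := hz (y := a.partner) hl.symm
  obtain ⟨f1, f2, f3, f4⟩ := sumBefore_twoSegs hw.nodup β.jump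
  set w := twoSegs d a b u v with hwd
  -- The difference of the two cycles. It lives on the two edges between the crossings, one on each
  -- strand, and is the boundary of the bigon; hence only the four passages there can contribute to
  -- its pairing with `β`, and they cancel.
  let δ : Chain := ⟨0, fun l => jumpAt a l - jumpAt b l⟩
  obtain ⟨e1, e2, e3, e4⟩ := sumBefore_twoSegs hw.nodup δ.jump
  rw [← hwd] at e1 e2 e3 e4
  have hsub : ∀ l, sumBefore w δ.jump l = sumBefore w (jumpAt a) l - sumBefore w (jumpAt b) l :=
    fun l => sum_map_sub' _ _ _
  have hb0 : sumBefore w (jumpAt b) b = 0 := by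
    rw [(sumBefore_twoSegs hw.nodup (jumpAt b)).2.1, hba']
  have ha0 : sumBefore w (jumpAt a) a = 0 := (sumBefore_twoSegs hw.nodup (jumpAt a)).1
  have hδ : pairing w δ β = 0 := by
    have h0 : ∀ l ∈ u ++ v, δ.jump l = 0 := by
      intro l hl
      have hn := (twoSegs_nodup hw.nodup).2.1 l hl
      simp only [List.mem_cons, List.not_mem_nil, or_false, not_or] at hn
      simp only [δ]
      rw [jumpAt_of_ne hn.1 hn.2.2.1, jumpAt_of_ne hn.2.1 hn.2.2.2, sub_zero]
    have h1 : (u.map δ.jump).sum = 0 := List.sum_eq_zero fun t ht => by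
      obtain ⟨l, hl, rfl⟩ := List.mem_map.1 ht
      exact h0 l (by simp [hl])
    have key : ((u ++ v).map (pairingAt w δ β)).sum = 0 := List.sum_eq_zero fun t ht => by
      obtain ⟨l, hl, rfl⟩ := List.mem_map.1 ht
      have hl' := partner_mem_of_twoSegs hw hl
      have h2 : sumBefore w δ.jump l.partner = 0 := by
        rw [hwd, sumBefore_twoSegs_of_mem hw.nodup hl' (by simp [δ, jumpAt_self, hba, hba'])
          (by simp [δ, jumpAt_partner_self, hba'', hba'''])]
        exact List.sum_eq_zero fun t ht => by
          obtain ⟨m, hm, rfl⟩ := List.mem_map.1 ht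
          exact h0 m ((List.takeWhile_sublist _).subset hm)
      have h3 : δ.base = 0 := rfl
      simp [pairingAt, Chain.outflow, Chain.inflow, h2, h0 _ hl', h3]
    rw [pairing]
    conv_lhs => rw [hwd, sum_map_twoSegs, ← hwd, key]
    have j1 : δ.jump a = 1 := by simp [δ, jumpAt_self, hba']
    have j2 : δ.jump b = -1 := by simp [δ, jumpAt_self, hba]
    have j3 : δ.jump a.partner = -1 := by simp [δ, jumpAt_partner_self, hba''']
    have j4 : δ.jump b.partner = 1 := by simp [δ, jumpAt_partner_self, hba'']
    have j5 : δ.base = 0 := rfl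
    simp only [pairingAt, Chain.outflow, Chain.inflow, Letter.partner_partner,
      Letter.isFirst_partner, hab, e1, e2, e3, e4, f1, f2, f3, f4, hβ a, hβ b, j1, j2, j3, j4, j5, h1]
    cases a.isFirst <;> cases d <;> simp <;> ring
  rw [pairing_eq_sub_left hw (b := loop w a) (c := loop w b) (fun l _ => by
    simp [Chain.inflow, loop, hsub, hb0, ha0, δ]) (fun l _ => rfl)] at hδ
  linarith

end SecondMove

/-! ### Invariance of the intersection polynomials -/

open LaurentPolynomial

/-- `∑ ε x (t ^ g x - 1)` -/
noncomputable def singleSum (C : List Letter) (g : Letter → ℤ) : ℤ[T;T⁻¹] :=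
  (C.map fun x => x.sign • (T (g x) - 1)).sum

/-- `∑ ε x ε y (t ^ E x y - 1)` -/
noncomputable def doubleSum (C : List Letter) (E : Letter → Letter → ℤ) : ℤ[T;T⁻¹] :=
  (C.map fun x => (C.map fun y => (x.sign * y.sign) • (T (E x y) - 1 : ℤ[T;T⁻¹])).sum).sum

theorem singleSum_cons (c : Letter) (C : List Letter) (g : Letter → ℤ) :
    singleSum (c :: C) g = c.sign • (T (g c) - 1) + singleSum C g := by
  simp [singleSum]

theorem singleSum_congr {C : List Letter} {g g' : Letter → ℤ} (h : ∀ x ∈ C, g x = g' x) :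
    singleSum C g = singleSum C g' := by
  rw [singleSum, singleSum, List.map_congr_left fun x hx => by rw [h x hx]]

theorem singleSum_zero {C : List Letter} {g : Letter → ℤ} (h : ∀ x ∈ C, g x = 0) :
    singleSum C g = 0 := by
  rw [singleSum_congr h]
  simp [singleSum]

theorem doubleSum_congr {C : List Letter} {E E' : Letter → Letter → ℤ}
    (h : ∀ x ∈ C, ∀ y ∈ C, E x y = E' x y) : doubleSum C E = doubleSum C E' := by
  rw [doubleSum, doubleSum, List.map_congr_left fun x hx => by
    rw [List.map_congr_left fun y hy => by rw [h x hx y hy]]]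

theorem singleSum_perm {C C' : List Letter} (h : C.Perm C') (g : Letter → ℤ) :
    singleSum C g = singleSum C' g := (h.map _).sum_eq

theorem doubleSum_perm {C C' : List Letter} (h : C.Perm C') (E : Letter → Letter → ℤ) :
    doubleSum C E = doubleSum C' E := by
  rw [doubleSum, (h.map _).sum_eq, doubleSum]
  simp only [(h.map _).sum_eq]

theorem sum_map_smul (z : ℤ) (C : List Letter) (g : Letter → ℤ[T;T⁻¹]) :
    (C.map fun x => z • g x).sum = z • (C.map g).sum := by
  induction C with
  | nil => simp
  | cons a C ih => simp only [List.map_cons, List.sum_cons, ih, smul_add]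

theorem Letter.sign_mul_self (c : Letter) : c.sign * c.sign = 1 := by
  unfold Letter.sign
  split <;> rfl

theorem doubleSum_cons (c : Letter) (C : List Letter) (E : Letter → Letter → ℤ) :
    doubleSum (c :: C) E = doubleSum C E + c.sign • singleSum C (E c) +
      c.sign • singleSum C (fun x => E x c) + (T (E c c) - 1) := by
  have h1 : (C.map fun y => (c.sign * y.sign) • (T (E c y) - 1 : ℤ[T;T⁻¹])).sum =
      c.sign • singleSum C (E c) := by
    simp only [mul_smul, sum_map_smul]; rfl
  have h2 : (C.map fun x => (x.sign * c.sign) • (T (E x c) - 1 : ℤ[T;T⁻¹])).sum =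
      c.sign • singleSum C fun x => E x c := by
    simp only [mul_comm _ c.sign, mul_smul, sum_map_smul]; rfl
  simp only [doubleSum, List.map_cons, List.sum_cons, List.sum_map_add, h1, h2, c.sign_mul_self,
    one_smul]
  abel

theorem invert_singleSum (C : List Letter) (g : Letter → ℤ) :
    invert (singleSum C g) = singleSum C fun x => -g x := by
  rw [singleSum, map_list_sum, List.map_map, singleSum]
  congr 1
  apply List.map_congr_left
  intro x _
  simp

/-- The symmetrized writhe polynomial of a family of indices. -/
noncomputable def symSum (C : List Letter) (ι : Letter → ℤ) : ℤ[T;T⁻¹] :=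
  singleSum C ι + singleSum C fun x => -ι x

/-- The first polynomial of a family of indices and linking numbers. -/
noncomputable def firstPoly (C : List Letter) (ι : Letter → ℤ) (Λ : Letter → Letter → ℤ) :
    ℤ[T;T⁻¹] :=
  doubleSum C (fun x y => ι x - Λ x y) - (C.map Letter.sign).sum • singleSum C ι

/-- The second polynomial of a family of indices and linking numbers. -/
noncomputable def secondPoly (C : List Letter) (ι : Letter → ℤ) (Λ : Letter → Letter → ℤ) :
    ℤ[T;T⁻¹] :=
  doubleSum C Λ + doubleSum C (fun x y => ι y - ι x + Λ x y) -
    (C.map Letter.sign).sum • symSum C ι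

/-- Two families have the same intersection polynomials. -/
structure SamePolys (C : List Letter) (ι : Letter → ℤ) (Λ : Letter → Letter → ℤ)
    (C' : List Letter) (ι' : Letter → ℤ) (Λ' : Letter → Letter → ℤ) : Prop where
  sym : symSum C ι = symSum C' ι'
  first : firstPoly C ι Λ = firstPoly C' ι' Λ'
  second : secondPoly C ι Λ = secondPoly C' ι' Λ'
  third : ∃ k : ℤ, doubleSum C Λ = doubleSum C' Λ' + k • symSum C' ι'

section SamePolys

variable {C C' C'' : List Letter} {ι ι' ι'' : Letter → ℤ} {Λ Λ' Λ'' : Letter → Letter → ℤ}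

theorem SamePolys.refl (C : List Letter) (ι : Letter → ℤ) (Λ : Letter → Letter → ℤ) :
    SamePolys C ι Λ C ι Λ := ⟨rfl, rfl, rfl, 0, by simp⟩

theorem SamePolys.symm (h : SamePolys C ι Λ C' ι' Λ') : SamePolys C' ι' Λ' C ι Λ := by
  obtain ⟨k, hk⟩ := h.third
  exact ⟨h.sym.symm, h.first.symm, h.second.symm, -k, by rw [hk, h.sym]; simp⟩

theorem SamePolys.trans (h : SamePolys C ι Λ C' ι' Λ') (h' : SamePolys C' ι' Λ' C'' ι'' Λ'') :
    SamePolys C ι Λ C'' ι'' Λ'' := by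
  obtain ⟨k, hk⟩ := h.third
  obtain ⟨m, hm⟩ := h'.third
  exact ⟨h.sym.trans h'.sym, h.first.trans h'.first, h.second.trans h'.second, m + k, by
    rw [hk, hm, h'.sym, add_smul, add_assoc]⟩

theorem samePolys_perm (h : C.Perm C') (hι : ∀ x ∈ C, ι x = ι' x)
    (hΛ : ∀ x ∈ C, ∀ y ∈ C, Λ x y = Λ' x y) : SamePolys C ι Λ C' ι' Λ' := by
  have e1 : singleSum C ι = singleSum C' ι' := by rw [← singleSum_perm h, singleSum_congr hι]
  have e2 : (singleSum C fun x => -ι x) = singleSum C' fun x => -ι' x := by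
    rw [← singleSum_perm h, singleSum_congr fun x hx => by rw [hι x hx]]
  have e3 : doubleSum C Λ = doubleSum C' Λ' := by rw [← doubleSum_perm h, doubleSum_congr hΛ]
  have e4 : doubleSum C (fun x y => ι x - Λ x y) = doubleSum C' fun x y => ι' x - Λ' x y := by
    rw [← doubleSum_perm h, doubleSum_congr fun x hx y hy => by rw [hι x hx, hΛ x hx y hy]]
  have e5 : doubleSum C (fun x y => ι y - ι x + Λ x y) =
      doubleSum C' fun x y => ι' y - ι' x + Λ' x y := by
    rw [← doubleSum_perm h, doubleSum_congr fun x hx y hy => by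
      rw [hι x hx, hι y hy, hΛ x hx y hy]]
  have e6 : (C.map Letter.sign).sum = (C'.map Letter.sign).sum := (h.map _).sum_eq
  constructor
  · rw [symSum, symSum, e1, e2]
  · rw [firstPoly, firstPoly, e1, e4, e6]
  · rw [secondPoly, secondPoly, symSum, symSum, e1, e2, e3, e5, e6]
  · exact ⟨0, by simp [e3]⟩

theorem samePolys_map {g : Letter → Letter} (hg : ∀ x, (g x).sign = x.sign)
    (hι : ∀ x, ι' (g x) = ι x) (hΛ : ∀ x y, Λ' (g x) (g y) = Λ x y) :
    SamePolys C ι Λ (C.map g) ι' Λ' := by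
  constructor
  · simp [symSum, singleSum, List.map_map, Function.comp_def, hg, hι]
  · simp [firstPoly, singleSum, doubleSum, List.map_map, Function.comp_def, hg, hι, hΛ]
  · simp [secondPoly, symSum, singleSum, doubleSum, List.map_map, Function.comp_def, hg, hι, hΛ]
  · exact ⟨0, by simp [doubleSum, List.map_map, Function.comp_def, hg, hΛ]⟩

/-- The first move. Either `γ` at `c` is homologous to zero, or it is homologous to the knot, whose
intersection number with `γ y` is `-ι y`. In the first polynomial exactly one of the row and the
column of `c` yields `c.sign` times the writhe polynomial, which the change of the writhe
compensates. In the second polynomial the same happens with the symmetrized sum, arising from `f11`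
in the first case and from `f00` in the second. The second case is why `f00` alone is invariant only
modulo `symSum`. -/
theorem samePolys_cons {c : Letter} (hc : ι c = 0) (hcc : Λ c c = 0)
    (h : (∀ y ∈ C, Λ c y = 0 ∧ Λ y c = 0) ∨ ∀ y ∈ C, Λ c y = -ι y ∧ Λ y c = ι y) :
    SamePolys (c :: C) ι Λ C ι Λ := by
  have e1 : singleSum (c :: C) ι = singleSum C ι := by simp [singleSum_cons, hc]
  have e2 : (singleSum (c :: C) fun x => -ι x) = singleSum C fun x => -ι x := by
    simp [singleSum_cons, hc]
  have e0 : symSum (c :: C) ι = symSum C ι := by rw [symSum, symSum, e1, e2]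
  rcases h with h | h
  · have e3 : doubleSum (c :: C) Λ = doubleSum C Λ := by
      rw [doubleSum_cons, singleSum_zero fun y hy => (h y hy).1,
        singleSum_zero fun y hy => (h y hy).2, hcc]
      simp
    refine ⟨e0, ?_, ?_, 0, by simp [e3]⟩
    · rw [firstPoly, firstPoly, e1, doubleSum_cons,
        singleSum_zero (g := fun y => ι c - Λ c y) fun y hy => by simp [hc, (h y hy).1],
        singleSum_congr (g := fun y => ι y - Λ y c) (g' := ι) fun y hy => by simp [(h y hy).2],
        hc, hcc]
      simp [add_smul]
      ring
    · rw [secondPoly, secondPoly, e0, e3, doubleSum_cons,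
        singleSum_congr (g := fun y => ι y - ι c + Λ c y) (g' := ι) fun y hy => by
          simp [hc, (h y hy).1],
        singleSum_congr (g := fun y => ι c - ι y + Λ y c) (g' := fun y => -ι y) fun y hy => by
          simp [hc, (h y hy).2], hc, hcc]
      simp [add_smul, symSum]
      abel
  · have e3 : doubleSum (c :: C) Λ = doubleSum C Λ + c.sign • symSum C ι := by
      rw [doubleSum_cons, singleSum_congr fun y hy => (h y hy).1,
        singleSum_congr fun y hy => (h y hy).2, hcc, symSum]
      simp
      abel
    refine ⟨e0, ?_, ?_, c.sign, e3⟩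
    · rw [firstPoly, firstPoly, e1, doubleSum_cons,
        singleSum_congr (g := fun y => ι c - Λ c y) (g' := ι) fun y hy => by simp [hc, (h y hy).1],
        singleSum_zero (g := fun y => ι y - Λ y c) fun y hy => by simp [(h y hy).2],
        hc, hcc]
      simp [add_smul]
      ring
    · rw [secondPoly, secondPoly, e0, e3, doubleSum_cons,
        singleSum_zero (g := fun y => ι y - ι c + Λ c y) fun y hy => by
          simp [hc, (h y hy).1],
        singleSum_zero (g := fun y => ι c - ι y + Λ y c) fun y hy => by
          simp [hc, (h y hy).2], hc, hcc]
      simp [add_smul]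
      abel

/-- The rows of `a` and `b` agree up to the opposite sign and so do their columns; they cancel. -/
theorem doubleSum_cons_cons {a b : Letter} {E : Letter → Letter → ℤ} (hs : b.sign = -a.sign)
    (h : ∀ y ∈ a :: b :: C, E a y = E b y) (h' : ∀ y ∈ a :: b :: C, E y a = E y b) :
    doubleSum (a :: b :: C) E = doubleSum C E := by
  have h1 : E a b = E b b := h b (by simp)
  have h2 : E a a = E b a := h a (by simp)
  have h3 : E b a = E b b := h' b (by simp)
  rw [doubleSum_cons, doubleSum_cons, singleSum_cons, singleSum_cons, hs,
    singleSum_congr (g := E a) (g' := E b) fun y hy => h y (by simp [hy]),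
    singleSum_congr (g := fun y => E y a) (g' := fun y => E y b) fun y hy => h' y (by simp [hy]),
    h2, h3, h1]
  have : a.sign = 1 ∨ a.sign = -1 := by
    unfold Letter.sign
    split <;> simp
  rcases this with hs | hs <;> rw [hs] <;> simp <;> abel

theorem samePolys_cons_cons {a b : Letter} (hs : b.sign = -a.sign) (hι : ι a = ι b)
    (h : ∀ y ∈ a :: b :: C, Λ a y = Λ b y) (h' : ∀ y ∈ a :: b :: C, Λ y a = Λ y b) :
    SamePolys (a :: b :: C) ι Λ C ι Λ := by
  have e1 : singleSum (a :: b :: C) ι = singleSum C ι := by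
    rw [singleSum_cons, singleSum_cons, hs, hι, neg_smul]; abel
  have e2 : (singleSum (a :: b :: C) fun x => -ι x) = singleSum C fun x => -ι x := by
    rw [singleSum_cons, singleSum_cons, hs, hι, neg_smul]; abel
  have e0 : symSum (a :: b :: C) ι = symSum C ι := by rw [symSum, symSum, e1, e2]
  have e3 := doubleSum_cons_cons hs h h'
  have e6 : ((a :: b :: C).map Letter.sign).sum = (C.map Letter.sign).sum := by simp [hs]
  refine ⟨e0, ?_, ?_, 0, by simp [e3]⟩
  · rw [firstPoly, firstPoly, e1, e6, doubleSum_cons_cons hs]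
    · exact fun y hy => by rw [hι, h y hy]
    · exact fun y hy => by rw [h' y hy]
  · rw [secondPoly, secondPoly, e0, e3, e6, doubleSum_cons_cons hs]
    · exact fun y hy => by rw [hι, h y hy]
    · exact fun y hy => by rw [hι, h' y hy]

end SamePolys

theorem mem_of_mem_overs {w : List Letter} {x : Letter} (h : x ∈ overs w) : x ∈ w :=
  (List.mem_filter.1 h).1

theorem samePolys_threeSegs {d₁ d₂ d₃ d₁' d₂' d₃' : Bool} {x₁ y₁ x₂ y₂ x₃ y₃ : Letter}
    {u v z : List Letter}
    (h : ∀ x y, linking (threeSegs d₁ d₂ d₃ x₁ y₁ x₂ y₂ x₃ y₃ u v z) x y =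
        linking (threeSegs d₁' d₂' d₃' x₁ y₁ x₂ y₂ x₃ y₃ u v z) x y ∧
      index (threeSegs d₁ d₂ d₃ x₁ y₁ x₂ y₂ x₃ y₃ u v z) x =
        index (threeSegs d₁' d₂' d₃' x₁ y₁ x₂ y₂ x₃ y₃ u v z) x) :
    let w := threeSegs d₁ d₂ d₃ x₁ y₁ x₂ y₂ x₃ y₃ u v z
    let w' := threeSegs d₁' d₂' d₃' x₁ y₁ x₂ y₂ x₃ y₃ u v z
    SamePolys (overs w) (index w) (linking w) (overs w') (index w') (linking w') :=
  samePolys_perm ((threeSegs_perm d₁ d₂ d₃ d₁' d₂' d₃' _ _ _ _ _ _ u v z).filter _)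
    (fun x _ => (h x x).2) fun x _ y _ => (h x y).1

/-- The polynomials do not change under the elementary changes of a Gauss code. -/
theorem Step.samePolys {w w' : List Letter} (h : Step w w') (hw : IsGaussCode w) :
    SamePolys (overs w) (index w) (linking w) (overs w') (index w') (linking w') := by
  cases h with
  | rotate u v =>
    exact samePolys_perm (List.perm_append_comm.filter _)
      (fun x hx => index_rotate hw (mem_of_mem_overs hx))
      fun x hx y hy => linking_rotate hw (mem_of_mem_overs hx) (mem_of_mem_overs hy)
  | relabel f hf w =>
    have e : overs (w.map (Letter.rename f)) = (overs w).map (Letter.rename f) := by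
      rw [overs, overs, List.filter_map]; rfl
    change SamePolys _ _ _ (overs (w.map (Letter.rename f))) (index (w.map (Letter.rename f)))
      (linking (w.map (Letter.rename f)))
    rw [e]
    exact samePolys_map (fun _ => rfl) (index_rename hf w) (linking_rename hf w)
  | r1 c o p w =>
    have h0 : ∀ {y}, y ∈ overs w' → y ∈ w' := mem_of_mem_overs
    let x : Letter := ⟨c, o, p⟩
    change IsGaussCode (x :: x.partner :: w') at hw
    have hι : ∀ y ∈ overs w', index (x :: x.partner :: w') y = index w' y :=
      fun y hy => index_cons_partner hw (h0 hy)
    have hx0 : index (x :: x.partner :: w') x = 0 :=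
      pairing_loop_cons_partner hw knotChain_isCycle
    have hl0 : ∀ y, linking (x :: x.partner :: w') x y = 0 :=
      fun y => pairing_loop_cons_partner hw (loop_isCycle _ _)
    have hr0 : ∀ y, linking (x :: x.partner :: w') y x = 0 := fun y => by
      rw [linking_comm hw, hl0, neg_zero]
    refine SamePolys.trans ?_ (samePolys_perm (List.Perm.refl _) hι
      fun y hy z hz => linking_cons_partner hw (h0 hy) (h0 hz))
    change SamePolys (overs (x :: x.partner :: w')) (index (x :: x.partner :: w'))
      (linking (x :: x.partner :: w')) _ _ _
    -- If the first passage `x` of the kink is the over-passage, then `γ` is the kink. Otherwise the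
    -- kink is `γ̄`, and `γ` is homologous to the whole knot.
    cases o with
    | true =>
      have e : overs (x :: x.partner :: w') = x :: overs w' := by simp [overs, x]
      rw [e]
      exact samePolys_cons hx0 (hl0 x) (Or.inl fun y _ => ⟨hl0 y, hr0 y⟩)
    | false =>
      have e : overs (x :: x.partner :: w') = x.partner :: overs w' := by simp [overs, x]
      have hr : ∀ y, linking (x :: x.partner :: w') y x.partner =
          index (x :: x.partner :: w') y := fun y => by
        rw [linking_partner_right hw y (by simp), hr0, sub_zero]
      rw [e]
      refine samePolys_cons (by rw [index_partner hw (by simp), hx0, neg_zero]) (linking_self hw _)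
        (Or.inr fun y _ => ⟨by rw [linking_comm hw, hr], hr y⟩)
  | r2 a b p d u v =>
    let A : Letter := ⟨a, true, p⟩
    let B : Letter := ⟨b, true, !p⟩
    change IsGaussCode (twoSegs d A B u v) at hw
    change SamePolys (overs (twoSegs d A B u v)) (index (twoSegs d A B u v))
      (linking (twoSegs d A B u v)) _ _ _
    have hab : B.isFirst = !A.isFirst := by cases p <;> rfl
    have hn : A.label ≠ B.label := by
      refine hw.label_ne (by simp [twoSegs]) (by simp [twoSegs]) ?_ rfl
      intro e
      have := congrArg Letter.pos e
      simp [A, B] at this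
    have e : overs (twoSegs d A B u v) = A :: B :: overs (u ++ v) := by
      cases d <;> simp [overs, twoSegs, seg, A, B, Letter.partner]
    have hl : ∀ y, linking (twoSegs d A B u v) A y = linking (twoSegs d A B u v) B y :=
      fun y => pairing_loop_twoSegs hw hab hn (loop_isCycle _ _)
    rw [e]
    refine SamePolys.trans (samePolys_cons_cons (by cases p <;> rfl)
      (pairing_loop_twoSegs hw hab hn knotChain_isCycle) (fun y _ => hl y)
      fun y _ => by rw [linking_comm hw, hl, ← linking_comm hw]) ?_
    exact samePolys_perm (List.Perm.refl _)
      (fun y hy => index_twoSegs hw hab (mem_of_mem_overs hy))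
      fun y hy z hz => linking_twoSegs hw hab (mem_of_mem_overs hy) (mem_of_mem_overs hz)
  | r3 a b c κ t m e u v z => exact samePolys_threeSegs (pairing_r3 a b c κ t m e u v z hw)
  | r3' a b c κ t m e u v z => exact samePolys_threeSegs (pairing_r3' a b c κ t m e u v z hw)

/-! ### The polynomials of a diagram in terms of index and linking numbers. -/

namespace GaussDiagram

variable (D : GaussDiagram)

theorem partner_mem {x : Letter} (hx : x ∈ D.crossings) : x.partner ∈ D.code :=
  D.isGaussCode.partner_mem x (mem_of_mem_overs hx)

theorem intersection_gam_gam {x y : Letter} (hx : x ∈ D.crossings) (hy : y ∈ D.crossings) :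
    intersection (D.gam x) (D.gam y) = linking D.code x y :=
  intersection_eq_pairing D.isGaussCode (mem_of_mem_overs hx) (mem_of_mem_overs hy)

theorem intersection_gam_gamBar {x y : Letter} (hx : x ∈ D.crossings) (hy : y ∈ D.crossings) :
    intersection (D.gam x) (D.gamBar y) = index D.code x - linking D.code x y := by
  rw [← linking_partner_right D.isGaussCode x (mem_of_mem_overs hy)]
  exact intersection_eq_pairing D.isGaussCode (mem_of_mem_overs hx) (D.partner_mem hy)

theorem intersection_gamBar_gamBar {x y : Letter} (hx : x ∈ D.crossings)
    (hy : y ∈ D.crossings) : intersection (D.gamBar x) (D.gamBar y) =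
      index D.code y - index D.code x + linking D.code x y := by
  rw [← linking_partner_partner D.isGaussCode (mem_of_mem_overs hx) (mem_of_mem_overs hy)]
  exact intersection_eq_pairing D.isGaussCode (D.partner_mem hx) (D.partner_mem hy)

/-- As `γ · γ = 0`, the number `γ · γ̄` is the intersection number of `γ` with the knot. -/
theorem W_eq : D.W = singleSum D.crossings (index D.code) :=
  singleSum_congr (g := fun x => intersection (D.gam x) (D.gamBar x)) fun x hx => by
    rw [D.intersection_gam_gamBar hx hx, linking_self D.isGaussCode, sub_zero]

theorem Wbar_eq : D.Wbar = symSum D.crossings (index D.code) := by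
  rw [Wbar, W_eq, invert_singleSum, symSum]

theorem f00_eq : D.f00 = doubleSum D.crossings (linking D.code) :=
  doubleSum_congr fun _ hx _ hy => D.intersection_gam_gam hx hy

theorem f01_eq :
    D.f01 = doubleSum D.crossings fun x y => index D.code x - linking D.code x y :=
  doubleSum_congr fun _ hx _ hy => D.intersection_gam_gamBar hx hy

theorem f11_eq : D.f11 = doubleSum D.crossings fun x y =>
    index D.code y - index D.code x + linking D.code x y :=
  doubleSum_congr fun _ hx _ hy => D.intersection_gamBar_gamBar hx hy

theorem polyI_eq : D.polyI = firstPoly D.crossings (index D.code) (linking D.code) := by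
  rw [polyI, f01_eq, W_eq]; rfl

theorem polyII_eq : D.polyII = secondPoly D.crossings (index D.code) (linking D.code) := by
  rw [polyII, f00_eq, f11_eq, Wbar_eq]; rfl

end GaussDiagram

/-- Diagrams of the same virtual knot have the same polynomials. -/
theorem samePolys_of_mk_eq {D D' : GaussDiagram} (h : Quot.mk Move D = Quot.mk Move D') :
    SamePolys D.crossings (index D.code) (linking D.code)
      D'.crossings (index D'.code) (linking D'.code) := by
  have := Quot.eqvGen_exact h
  clear h
  induction this with
  | rel D D' h => exact Step.samePolys h D.isGaussCode
  | refl D => exact SamePolys.refl _ _ _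
  | symm _ _ _ ih => exact ih.symm
  | trans _ _ _ _ _ ih ih' => exact ih.trans ih'

theorem polyI_eq_of_mk_eq {D D' : GaussDiagram} (h : Quot.mk Move D = Quot.mk Move D') :
    D.polyI = D'.polyI := by
  rw [D.polyI_eq, D'.polyI_eq, (samePolys_of_mk_eq h).first]

theorem polyII_eq_of_mk_eq {D D' : GaussDiagram} (h : Quot.mk Move D = Quot.mk Move D') :
    D.polyII = D'.polyII := by
  rw [D.polyII_eq, D'.polyII_eq, (samePolys_of_mk_eq h).second]

theorem classIII_eq_of_mk_eq {D D' : GaussDiagram} (h : Quot.mk Move D = Quot.mk Move D') :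
    D.classIII = D'.classIII := by
  obtain ⟨k, hk⟩ := (samePolys_of_mk_eq h).third
  have hs := (samePolys_of_mk_eq h).sym
  ext g
  simp only [GaussDiagram.classIII, Set.mem_ofPred_eq, D.f00_eq, D'.f00_eq, D.Wbar_eq, D'.Wbar_eq,
    hs, hk]
  constructor
  · rintro ⟨m, hm⟩
    exact ⟨m + k, by rw [add_smul, ← hm]; abel⟩
  · rintro ⟨m, hm⟩
    exact ⟨m - k, by rw [sub_smul, ← hm]; abel⟩

/-! ### Planar curves -/

theorem formPerm_symm_mem {w : List Letter} {l : Letter} (h : l ∈ w) : w.formPerm.symm l ∈ w := by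
  rw [← List.formPerm_mem_iff_mem]
  simpa using h

theorem HalfEdge.opposite_letter_mem {w : List Letter} {h : HalfEdge} (hh : h.letter ∈ w) :
    (h.opposite w).letter ∈ w := by
  unfold HalfEdge.opposite
  split
  · exact List.formPerm_apply_mem_of_mem hh
  · exact formPerm_symm_mem hh

theorem HalfEdge.opposite_opposite (w : List Letter) (h : HalfEdge) :
    (h.opposite w).opposite w = h := by
  obtain ⟨l, b⟩ := h
  cases b <;> simp [HalfEdge.opposite]

theorem HalfEdge.turn_turn (h : HalfEdge) : h.turn.turn = ⟨h.letter, !h.out⟩ := by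
  obtain ⟨⟨c, o, p⟩, b⟩ := h
  cases o <;> cases p <;> cases b <;> rfl

theorem HalfEdge.face_letter_mem {w : List Letter} (hw : IsGaussCode w) {h : HalfEdge}
    (hh : h.letter ∈ w) : (h.face w).letter ∈ w :=
  hw.partner_mem _ (HalfEdge.opposite_letter_mem hh)

/-- The faces of the surface of a Gauss code. -/
def Faces (w : List Letter) : Type :=
  Quot fun h h' : {h : HalfEdge // h.letter ∈ w} => h'.1 = h.1.face w

instance (w : List Letter) : Finite {h : HalfEdge // h.letter ∈ w} := by
  have : Finite {l : Letter // l ∈ w} := w.finite_toSet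
  apply Finite.of_injective (fun h : {h : HalfEdge // h.letter ∈ w} =>
    ((⟨h.1.letter, h.2⟩ : {l // l ∈ w}), h.1.out))
  rintro ⟨⟨l, b⟩, h⟩ ⟨⟨l', b'⟩, h'⟩ e
  simp only [Prod.mk.injEq, Subtype.mk.injEq] at e
  obtain ⟨rfl, rfl⟩ := e
  rfl

instance (w : List Letter) : Finite (Faces w) := Finite.of_surjective _ Quot.mk_surjective

instance (w : List Letter) : Finite {l : Letter // l ∈ w} := w.finite_toSet

/-- The face on the right of a half-edge. -/
def Faces.mk {w : List Letter} (h : HalfEdge) (hh : h.letter ∈ w) : Faces w := Quot.mk _ ⟨h, hh⟩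

theorem Faces.mk_face {w : List Letter} {h : HalfEdge} (hh : h.letter ∈ w)
    (hh' : (h.face w).letter ∈ w) : Faces.mk (h.face w) hh' = Faces.mk h hh :=
  (Quot.sound (r := fun h h' : {h : HalfEdge // h.letter ∈ w} => h'.1 = h.1.face w)
    (a := ⟨h, hh⟩) (b := ⟨h.face w, hh'⟩) rfl).symm

theorem Faces.exists_mk {w : List Letter} (q : Faces w) : ∃ h hh, q = Faces.mk h hh := by
  induction q using Quot.ind with
  | mk h => exact ⟨h.1, h.2, rfl⟩

open Classical in
/-- The value of a function on the faces at the face on the right of a half-edge. -/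
noncomputable def faceValue (w : List Letter) (h : HalfEdge) : (Faces w → ℚ) →ₗ[ℚ] ℚ :=
  if hh : h.letter ∈ w then LinearMap.proj (Faces.mk h hh) else 0

theorem faceValue_face {w : List Letter} (hw : IsGaussCode w) {h : HalfEdge} (hh : h.letter ∈ w) :
    faceValue w (h.face w) = faceValue w h := by
  rw [faceValue, faceValue, dif_pos hh, dif_pos (HalfEdge.face_letter_mem hw hh),
    Faces.mk_face hh]

theorem faceValue_opposite {w : List Letter} (hw : IsGaussCode w) {h : HalfEdge}
    (hh : h.letter ∈ w) : faceValue w (h.opposite w) = faceValue w h.turn := by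
  rw [← faceValue_face hw (HalfEdge.opposite_letter_mem hh), HalfEdge.face,
    HalfEdge.opposite_opposite]

/-- The boundary of a two-chain: on every edge, the value on the left minus the value on the
right. Edges are named by the passages that they leave. -/
noncomputable def boundary (w : List Letter) : (Faces w → ℚ) →ₗ[ℚ] ({l : Letter // l ∈ w} → ℚ) :=
  LinearMap.pi fun l => faceValue w ⟨w.formPerm l, false⟩ - faceValue w ⟨l, true⟩

theorem boundary_apply {w : List Letter} (n : Faces w → ℚ) (l : {l : Letter // l ∈ w}) :
    boundary w n l = faceValue w ⟨w.formPerm l, false⟩ n - faceValue w ⟨l, true⟩ n := rfl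

theorem faceValue_formPerm {w : List Letter} (hw : IsGaussCode w) {l : Letter} (hl : l ∈ w) :
    faceValue w ⟨w.formPerm l, false⟩ = faceValue w (HalfEdge.turn ⟨l, true⟩) := by
  rw [← faceValue_opposite hw (h := ⟨l, true⟩) hl]
  rfl

theorem faceValue_formPerm_symm {w : List Letter} (hw : IsGaussCode w) {l : Letter} (hl : l ∈ w) :
    faceValue w ⟨w.formPerm.symm l, true⟩ = faceValue w (HalfEdge.turn ⟨l, false⟩) := by
  rw [← faceValue_opposite hw (h := ⟨l, false⟩) hl]
  rfl

/-! ### The cellular chain complex of the surface and the vanishing of its first homology. -/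

section CycleSpace

variable {w : List Letter}

/-- The previous passage. -/
def prevPassage (w : List Letter) (l : {l : Letter // l ∈ w}) : {l : Letter // l ∈ w} :=
  ⟨w.formPerm.symm l, formPerm_symm_mem l.2⟩

/-- The partner among the passages of a Gauss code. -/
def partnerPassage (hw : IsGaussCode w) (l : {l : Letter // l ∈ w}) : {l : Letter // l ∈ w} :=
  ⟨l.1.partner, hw.partner_mem _ l.2⟩

/-- The multiplicity of a one-chain on an edge. -/
def multiplicity {v : List Letter} (l : {l : Letter // l ∈ v}) :
    ({l : Letter // l ∈ v} → ℚ) →ₗ[ℚ] ℚ := LinearMap.proj l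

/-- The excess of a one-chain at the crossing of a passage. -/
def excess (hw : IsGaussCode w) : ({l : Letter // l ∈ w} → ℚ) →ₗ[ℚ] ({l : Letter // l ∈ w} → ℚ) :=
  LinearMap.pi fun l => multiplicity l + multiplicity (partnerPassage hw l) -
    multiplicity (prevPassage w l) - multiplicity (prevPassage w (partnerPassage hw l))

theorem excess_apply (hw : IsGaussCode w) (G : {l : Letter // l ∈ w} → ℚ) (l : {l : Letter // l ∈ w}) :
    excess hw G l = G l + G (partnerPassage hw l) - G (prevPassage w l) -
      G (prevPassage w (partnerPassage hw l)) := rfl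

theorem boundary_prevPassage (hw : IsGaussCode w) (n : Faces w → ℚ) (l : {l : Letter // l ∈ w}) :
    boundary w n (prevPassage w l) =
      faceValue w ⟨l, false⟩ n - faceValue w (HalfEdge.turn ⟨l, false⟩) n := by
  rw [boundary_apply, ← faceValue_formPerm_symm hw l.2]
  simp [prevPassage]

theorem boundary_eq_turn (hw : IsGaussCode w) (n : Faces w → ℚ) (l : {l : Letter // l ∈ w}) : boundary w n l =
    faceValue w (HalfEdge.turn ⟨l, true⟩) n - faceValue w ⟨l, true⟩ n := by
  rw [boundary_apply, faceValue_formPerm hw l.2]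

/-- At a crossing each of the four corners lies between two half-edges, and its value enters the
excess once with each sign. -/
theorem range_boundary_le_ker_excess (hw : IsGaussCode w) :
    LinearMap.range (boundary w) ≤ LinearMap.ker (excess hw) := by
  rintro _ ⟨n, rfl⟩
  rw [LinearMap.mem_ker]
  ext ⟨⟨c, o, p⟩, hl⟩
  rw [excess_apply, boundary_prevPassage hw, boundary_prevPassage hw, boundary_eq_turn hw,
    boundary_eq_turn hw]
  cases o <;> cases p <;> simp [partnerPassage, HalfEdge.turn, Letter.partner]

/-- A function that is constant along the knot is constant. -/
theorem eq_of_forall_formPerm (hd : w.Nodup) {X : Type*} {f : Letter → X}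
    (h : ∀ l ∈ w, f (w.formPerm l) = f l) {l m : Letter} (hl : l ∈ w) (hm : m ∈ w) :
    f l = f m := by
  have key : ∀ i (hi : i < w.length), f w[i] = f (w[0]'(by omega)) := by
    intro i
    induction i with
    | zero => intro _; rfl
    | succ i ih =>
      intro hi
      rw [← List.formPerm_apply_lt_getElem w hd i hi, h _ (List.getElem_mem _), ih]
  obtain ⟨i, hi, rfl⟩ := List.getElem_of_mem hl
  obtain ⟨j, hj, rfl⟩ := List.getElem_of_mem hm
  rw [key, key j]

/-- The surface is connected, so a two-cycle is determined by its value on one face. -/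
theorem finrank_ker_boundary_le (hw : IsGaussCode w) :
    Module.finrank ℚ (LinearMap.ker (boundary w)) ≤ 1 := by
  by_cases hne : ∃ l, l ∈ w
  swap
  · have : IsEmpty (Faces w) := ⟨fun q => by
      obtain ⟨h, hh, -⟩ := q.exists_mk
      exact hne ⟨_, hh⟩⟩
    refine (Submodule.finrank_le _).trans ?_
    rw [Module.finrank_zero_of_subsingleton]
    omega
  obtain ⟨l₀, hl₀⟩ := hne
  let e : LinearMap.ker (boundary w) →ₗ[ℚ] ℚ :=
    (faceValue w ⟨l₀, true⟩).comp (LinearMap.ker (boundary w)).subtype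
  have he : Function.Injective e := by
    rw [injective_iff_map_eq_zero]
    rintro ⟨n, hn⟩ h0
    change faceValue w ⟨l₀, true⟩ n = 0 at h0
    have hb : ∀ l ∈ w, faceValue w ⟨w.formPerm l, false⟩ n = faceValue w ⟨l, true⟩ n := by
      intro l hl
      have := congrFun hn ⟨l, hl⟩
      rw [boundary_apply] at this
      simpa [sub_eq_zero] using this
    -- The value `n` is the same on both sides of every edge. Since `h.opposite w` and `h.turn` have
    -- the same face, it is then the same at all corners of a crossing, and following the knot
    -- reaches every face.
    have ho : ∀ h : HalfEdge, h.letter ∈ w → faceValue w (h.opposite w) n = faceValue w h n := by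
      rintro ⟨l, b⟩ hl
      cases b
      · have := hb _ (formPerm_symm_mem hl)
        simpa [HalfEdge.opposite] using this.symm
      · exact hb l hl
    have ht : ∀ h : HalfEdge, h.letter ∈ w → faceValue w h.turn n = faceValue w h n := by
      intro h hh
      rw [← faceValue_opposite hw hh, ho h hh]
    have hf : ∀ l ∈ w, faceValue w ⟨l, false⟩ n = faceValue w ⟨l, true⟩ n := by
      intro l hl
      rw [← ht ⟨l, false⟩ hl, ← ht _ (hw.partner_mem l hl), HalfEdge.turn_turn]
      rfl
    have hc : ∀ l ∈ w, faceValue w ⟨l, true⟩ n = 0 := by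
      intro l hl
      rw [← h0]
      refine eq_of_forall_formPerm hw.nodup (f := fun l => faceValue w ⟨l, true⟩ n) ?_ hl hl₀
      intro l hl
      rw [← hf _ (List.formPerm_apply_mem_of_mem hl), hb l hl]
    ext q
    obtain ⟨⟨l, b⟩, hl, rfl⟩ := q.exists_mk
    have : faceValue w ⟨l, b⟩ n = 0 := by
      cases b
      · rw [hf l hl, hc l hl]
      · exact hc l hl
    rw [faceValue, dif_pos hl] at this
    exact this
  simpa using LinearMap.finrank_le_finrank_of_injective he

theorem natCard_mem {w : List Letter} (h : w.Nodup) : Nat.card {l : Letter // l ∈ w} = w.length := by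
  rw [Nat.card_congr (Equiv.subtypeEquivRight (q := fun l => l ∈ w.toFinset) (by simp)),
    Nat.card_eq_fintype_card, Fintype.card_coe, List.toFinset_card_of_nodup h]

/-- A cycle is determined by its multiplicity on one edge and its jumps at the over-passages:
vanishing excess gives the jumps at the under-passages, and the knot runs through all edges. -/
theorem finrank_ker_excess_le (hw : IsGaussCode w) :
    Module.finrank ℚ (LinearMap.ker (excess hw)) ≤ (overs w).length + 1 := by
  have hov : Nat.card {l : Letter // l ∈ overs w} = (overs w).length :=
    natCard_mem (hw.nodup.filter _)
  by_cases hne : ∃ l, l ∈ w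
  swap
  · have : IsEmpty {l : Letter // l ∈ w} := ⟨fun l => hne ⟨l.1, l.2⟩⟩
    exact (Submodule.finrank_le _).trans (by simp)
  obtain ⟨l₀, hl₀⟩ := hne
  let ι : {l : Letter // l ∈ overs w} → {l : Letter // l ∈ w} := fun l =>
    ⟨l.1, mem_of_mem_overs l.2⟩
  let e₀ : ({l : Letter // l ∈ w} → ℚ) →ₗ[ℚ] ℚ × ({l : Letter // l ∈ overs w} → ℚ) :=
    (multiplicity ⟨l₀, hl₀⟩).prod
      (LinearMap.pi fun l => multiplicity (ι l) - multiplicity (prevPassage w (ι l)))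
  let e := e₀.comp (LinearMap.ker (excess hw)).subtype
  have he : Function.Injective e := by
    rw [injective_iff_map_eq_zero]
    rintro ⟨G, hG⟩ h0
    have h1 : G ⟨l₀, hl₀⟩ = 0 := congrArg Prod.fst h0
    have h2 : ∀ l (hl : l ∈ w), l.isOver → G ⟨l, hl⟩ = G (prevPassage w ⟨l, hl⟩) := by
      intro l hl ho
      have := congrFun (congrArg Prod.snd h0) ⟨l, List.mem_filter.2 ⟨hl, ho⟩⟩
      exact sub_eq_zero.1 this
    have h3 : ∀ l (hl : l ∈ w), G ⟨l, hl⟩ = G (prevPassage w ⟨l, hl⟩) := by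
      intro l hl
      by_cases ho : l.isOver
      · exact h2 l hl ho
      · have h4 := h2 _ (hw.partner_mem l hl) (by simpa using ho)
        have h5 := congrFun hG ⟨l, hl⟩
        rw [excess_apply] at h5
        simp only [partnerPassage, Pi.zero_apply] at h5
        linarith
    have hz : ∀ l ∈ w, (if h : l ∈ w then G ⟨l, h⟩ else 0) = 0 := by
      intro l hl
      rw [eq_of_forall_formPerm hw.nodup (f := fun l => if h : l ∈ w then G ⟨l, h⟩ else 0) ?_ hl hl₀,
        dif_pos hl₀, h1]
      intro l hl
      have hl' := List.formPerm_apply_mem_of_mem hl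
      rw [dif_pos hl', dif_pos hl, h3]
      simp [prevPassage]
    ext ⟨l, hl⟩
    have := hz l hl
    rwa [dif_pos hl] at this
  have := LinearMap.finrank_le_finrank_of_injective he
  have hc := Fintype.ofFinite {l : Letter // l ∈ overs w}
  rw [Module.finrank_prod, Module.finrank_self, Module.finrank_fintype_fun_eq_card,
    ← Nat.card_eq_fintype_card, hov] at this
  omega

theorem length_eq_two_mul_overs (hw : IsGaussCode w) : w.length = 2 * (overs w).length := by
  have h := sum_map_reindex hw fun l => if l.isOver then 1 else 0
  have h1 : ∀ v : List Letter, (v.map fun l => if l.isOver then 1 else 0).sum = (overs v).length := by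
    intro v
    induction v with
    | nil => rfl
    | cons a v ih => cases ha : a.isOver <;> simp [overs, ha] at ih ⊢ <;> omega
  have h2 : ∀ v : List Letter, (v.map fun l => if l.partner.isOver then 1 else 0).sum +
      (v.map fun l => if l.isOver then 1 else 0).sum = v.length := by
    intro v
    induction v with
    | nil => rfl
    | cons a v ih => cases ha : a.isOver <;> simp [ha] at ih ⊢ <;> omega
  have := h2 w
  rw [h, h1] at this
  omega

/-- With `V` crossings there are `2 V` edges, so planarity means `V + 2` faces. The boundary map
therefore has rank at least `V + 1`, which already bounds the dimension of the space of cycles that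
contains its range. -/
theorem range_boundary_eq (hw : IsGaussCode w) (hp : IsPlanar w) (hne : w ≠ []) :
    LinearMap.range (boundary w) = LinearMap.ker (excess hw) := by
  have hE := hp.resolve_left hne
  have h1 := length_eq_two_mul_overs hw
  have h2 := finrank_ker_boundary_le hw
  have h3 := finrank_ker_excess_le hw
  have h4 := LinearMap.finrank_range_add_finrank_ker (boundary w)
  have hc := Fintype.ofFinite (Faces w)
  rw [Module.finrank_fintype_fun_eq_card, ← Nat.card_eq_fintype_card] at h4
  change ((overs w).length : ℤ) - w.length + Nat.card (Faces w) = 2 at hE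
  exact Submodule.eq_of_le_of_finrank_le (range_boundary_le_ker_excess hw) (by omega)

end CycleSpace

/-! ### Vanishing of intersection numbers on planar curves. -/

theorem sumBefore_getElem {w : List Letter} (hd : w.Nodup) (J : Letter → ℤ) (i : ℕ)
    (hi : i < w.length) : sumBefore w J w[i] = ((w.take i).map J).sum := by
  have hs : w.take i ++ w[i] :: w.drop (i + 1) = w := by simp
  have hd' : (w.take i ++ w[i] :: w.drop (i + 1)).Nodup := by rwa [hs]
  have hn : w[i] ∉ w.take i := fun h =>
    (List.nodup_append.1 hd').2.2 _ h _ List.mem_cons_self rfl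
  rw [show sumBefore w J w[i] = sumBefore (w.take i ++ w[i] :: w.drop (i + 1)) J w[i] by rw [hs],
    sumBefore_append_of_notMem hn, sumBefore_cons_self, add_zero]

theorem inflow_formPerm {w : List Letter} (hw : IsGaussCode w) {a : Chain} (ha : a.IsCycle)
    {l : Letter} (hl : l ∈ w) : a.inflow w (w.formPerm l) = a.outflow w l := by
  obtain ⟨i, hi, rfl⟩ := List.getElem_of_mem hl
  rw [List.formPerm_apply_getElem w hw.nodup]
  simp only [Chain.outflow, Chain.inflow, sumBefore_getElem hw.nodup]
  by_cases h : i + 1 < w.length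
  · simp only [Nat.mod_eq_of_lt h]
    rw [List.take_add_one]
    simp [hi, add_assoc]
  -- After the last passage the knot returns to the base point; the total jump of a cycle is zero,
  -- so the multiplicity there is again the base.
  · have h' : i + 1 = w.length := by omega
    have h0 := sum_jump_eq_zero hw ha
    rw [← List.take_length (l := w), ← h', List.take_add_one] at h0
    simp [hi] at h0
    simp only [h', Nat.mod_self]
    simp
    linarith

/-- On a planar curve all intersection numbers of cycles vanish. -/
theorem pairing_eq_zero_of_isPlanar {w : List Letter} (hw : IsGaussCode w) (hp : IsPlanar w)
    {a b : Chain} (ha : a.IsCycle) (hb : b.IsCycle) : pairing w a b = 0 := by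
  by_cases hne : w = []
  · subst hne; rfl
  have hin : ∀ {a : Chain}, a.IsCycle → ∀ {l}, l ∈ w →
      a.outflow w (w.formPerm.symm l) = a.inflow w l := by
    intro a ha l hl
    rw [← inflow_formPerm hw ha (formPerm_symm_mem hl), Equiv.apply_symm_apply]
  let G : {l : Letter // l ∈ w} → ℚ := fun l => a.outflow w l
  have hG : G ∈ LinearMap.range (boundary w) := by
    rw [range_boundary_eq hw hp hne, LinearMap.mem_ker]
    ext l
    rw [excess_apply]
    simp only [G, prevPassage, partnerPassage, hin ha l.2, hin ha (hw.partner_mem _ l.2)]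
    simp [Chain.outflow, ha l.1]
    ring
  obtain ⟨n, hn⟩ := hG
  have hout : ∀ l ∈ w, (a.outflow w l : ℚ) =
      faceValue w (HalfEdge.turn ⟨l, true⟩) n - faceValue w ⟨l, true⟩ n := by
    intro l hl
    rw [← boundary_eq_turn hw n ⟨l, hl⟩, hn]
  have hinf : ∀ l ∈ w, (a.inflow w l : ℚ) =
      faceValue w ⟨l, false⟩ n - faceValue w (HalfEdge.turn ⟨l, false⟩) n := by
    intro l hl
    rw [← boundary_prevPassage hw n ⟨l, hl⟩, hn, ← hin ha hl]
    rfl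
  -- Give each edge the weight `n` on its left times the multiplicity of `b`. Then `ψ l` is the
  -- weight of the edge entering `l` minus that of the edge leaving it, so its sum around the knot
  -- vanishes. By Kirchhoff's law for `b`, the pairing agrees with `ψ` crossing by crossing
  -- (`hloc`).
  let ψ : Letter → ℚ := fun l => faceValue w ⟨l, false⟩ n * b.inflow w l -
    faceValue w (HalfEdge.turn ⟨l, true⟩) n * b.outflow w l
  have hψ : (w.map ψ).sum = 0 := by
    have hperm : (w.map w.formPerm).Perm w := by
      rw [List.perm_ext_iff_of_nodup (hw.nodup.map w.formPerm.injective) hw.nodup]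
      intro l
      rw [List.mem_map]
      constructor
      · rintro ⟨m, hm, rfl⟩
        exact List.formPerm_apply_mem_of_mem hm
      · exact fun h => ⟨_, formPerm_symm_mem h, by simp⟩
    have h1 := (hperm.map fun l => faceValue w ⟨l, false⟩ n * (b.inflow w l : ℚ)).sum_eq
    rw [List.map_map] at h1
    have h2 : w.map ψ = w.map fun l => (faceValue w ⟨l, false⟩ n * (b.inflow w l : ℚ)) -
        ((fun l => faceValue w ⟨l, false⟩ n * (b.inflow w l : ℚ)) ∘ w.formPerm) l := by
      apply List.map_congr_left
      intro l hl
      simp only [ψ, Function.comp, inflow_formPerm hw hb hl, faceValue_formPerm hw hl]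
    rw [h2]
    have h3 : ∀ (v : List Letter) (φ χ : Letter → ℚ),
        (v.map fun l => φ l - χ l).sum = (v.map φ).sum - (v.map χ).sum := by
      intro v φ χ
      induction v with
      | nil => simp
      | cons x v ih => simp only [List.map_cons, List.sum_cons, ih]; ring
    rw [h3, h1, sub_self]
  have hloc : ∀ l ∈ w, ((pairingAt w a b l : ℚ) + pairingAt w a b l.partner) =
      ψ l + ψ l.partner := by
    intro l hl
    have hl' := hw.partner_mem l hl
    have h1 := hout l hl
    have h2 := hout _ hl'
    have h3 := hinf l hl
    have h4 := hinf _ hl'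
    have h5 : (b.outflow w l : ℚ) = b.inflow w l + b.jump l := by simp [Chain.outflow]
    have h6 : (b.outflow w l.partner : ℚ) = b.inflow w l.partner - b.jump l := by
      simp [Chain.outflow, hb l]; ring
    obtain ⟨c, o, p⟩ := l
    cases o <;> cases p <;>
      simp only [pairingAt, Letter.isFirst, Letter.partner, ψ, HalfEdge.turn, beq_self_eq_true,
        Bool.not_true, Bool.not_false, Bool.true_beq, Bool.false_beq, if_true, if_false,
        Bool.false_eq_true, Bool.xor_true, Bool.xor_false, Bool.true_xor]
        at h1 h2 h3 h4 h5 h6 ⊢ <;> push_cast <;> simp only [h1, h2, h3, h4, h5, h6] <;> ring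
  have hcast : ((pairing w a b : ℤ) : ℚ) = (w.map fun l => (pairingAt w a b l : ℚ)).sum := by
    rw [pairing]
    push_cast
    rw [List.map_map]
    rfl
  have h1 := sum_map_reindex hw fun l => (pairingAt w a b l : ℚ)
  have h2 := sum_map_reindex hw ψ
  have h3 : (w.map fun l => ((pairingAt w a b l : ℚ) + pairingAt w a b l.partner)).sum =
      (w.map fun l => ψ l + ψ l.partner).sum := by
    rw [List.map_congr_left hloc]
  rw [List.sum_map_add, List.sum_map_add, h1, h2, hψ, ← hcast] at h3
  have h4 : ((pairing w a b : ℤ) : ℚ) = 0 := by linarith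
  exact_mod_cast h4

/-! ### The number of virtual crossings bounds intersection numbers -/

/-- Deleting passages at which a chain has no jump does not affect its multiplicities elsewhere.
This compares cycles in a virtual diagram with those in its Gauss diagram. -/
theorem sumBefore_filter {s : ℕ → Bool} {J : Letter → ℤ} (hJ : ∀ l, s l.label = false → J l = 0)
    (w : List Letter) {l : Letter} (hl : s l.label = true) :
    sumBefore (w.filter fun l => s l.label) J l = sumBefore w J l := by
  induction w with
  | nil => rfl
  | cons a w ih =>
    by_cases ha : a = l
    · subst ha; simp [hl]
    · rw [sumBefore_cons_of_ne ha]
      cases hs : s a.label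
      · rw [List.filter_cons_of_neg (by simp [hs]), ih, hJ a hs, zero_add]
      · rw [List.filter_cons_of_pos (by simp [hs]), sumBefore_cons_of_ne ha, ih]

theorem sum_map_filter_add (p : Letter → Bool) (w : List Letter) (φ : Letter → ℤ) :
    ((w.filter p).map φ).sum + ((w.filter fun l => !p l).map φ).sum = (w.map φ).sum := by
  induction w with
  | nil => rfl
  | cons a w ih => cases h : p a <;> simp [h, ← ih] <;> ring

theorem abs_sum_map_le {w : List Letter} {φ : Letter → ℤ} (h : ∀ l ∈ w, |φ l| ≤ 1) :
    |(w.map φ).sum| ≤ w.length := by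
  induction w with
  | nil => simp
  | cons a w ih =>
    have h1 := h a (by simp)
    have h2 := ih fun l hl => h l (by simp [hl])
    have h3 := abs_add_le (φ a) (w.map φ).sum
    simp only [List.map_cons, List.sum_cons, List.length_cons]
    push_cast
    linarith

/-- The heart of the proof: the contributions of real and virtual crossings to an intersection
number on the planar curve add up to zero, and each virtual crossing contributes -1, 0 or 1. -/
theorem VirtualDiagram.abs_linking_le (V : VirtualDiagram) {x y : Letter}
    (hx : x ∈ V.gaussDiagram.code) (hy : y ∈ V.gaussDiagram.code) :
    |linking V.gaussDiagram.code x y| ≤ V.numVirtual := by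
  set w := V.curve.code with hwdef
  have hw : IsGaussCode w := V.curve.isGaussCode
  let s : ℕ → Bool := fun c => !V.isVirtual c
  set v := w.filter fun l => s l.label with hv
  change x ∈ v at hx
  change y ∈ v at hy
  change |linking v x y| ≤ _
  have hvG : IsGaussCode v := hw.filter s
  set z := w.filter fun l => !s l.label with hz
  have hzG : IsGaussCode z := hw.filter fun c => !s c
  have hs : ∀ {l}, l ∈ v → s l.label = true := fun h => (List.mem_filter.1 h).2
  have hvw : ∀ {l}, l ∈ v → l ∈ w := fun h => (List.mem_filter.1 h).1
  have hJ : ∀ {x}, x ∈ v → ∀ l : Letter, s l.label = false → jumpAt x l = 0 := by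
    intro x hx l hl
    have hx := hs hx
    refine jumpAt_of_ne ?_ ?_ <;> rintro rfl <;> simp [hx] at hl
  have hloop : ∀ {x}, x ∈ v → loop v x = loop w x := by
    intro x hx
    rw [loop, loop, hv, sumBefore_filter (hJ hx) w (hs hx)]
  have hin : ∀ {x}, x ∈ v → ∀ {l}, l ∈ v → (loop w x).inflow v l = (loop w x).inflow w l := by
    intro x hx l hl
    rw [Chain.inflow, Chain.inflow, hv]
    congr 1
    exact sumBefore_filter (hJ hx) w (hs hl)
  have h0 := pairing_eq_zero_of_isPlanar hw V.planar (loop_isCycle w x) (loop_isCycle w y)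
  rw [pairing, ← sum_map_filter_add fun l => s l.label, ← hv, ← hz] at h0
  have h1 : linking v x y = (v.map (pairingAt w (loop w x) (loop w y))).sum := by
    rw [linking, hloop hx, hloop hy, pairing]
    congr 1
    apply List.map_congr_left
    intro l hl
    have hl' := hvG.partner_mem l hl
    simp only [pairingAt, Chain.outflow, hin hx hl', hin hy hl]
  -- Estimating single passages would lose a factor 2, so the two products at each virtual crossing
  -- are first combined into a determinant of zeros and ones. The doubled sum counts each crossing
  -- twice, as `z.length` does.
  have h2 : |(z.map (pairingAt w (loop w x) (loop w y))).sum +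
      (z.map (pairingAt w (loop w x) (loop w y))).sum| ≤ z.length := by
    nth_rw 2 [← sum_map_reindex hzG]
    rw [← sum_map_add']
    apply abs_sum_map_le
    intro l hl
    have hlw : l ∈ w := (List.mem_filter.1 hl).1
    have hls : s l.label = false := by simpa using (List.mem_filter.1 hl).2
    have j1 : (loop w x).jump l = 0 := hJ hx l hls
    have j2 : (loop w y).jump l = 0 := hJ hy l hls
    have j3 : (loop w x).jump l.partner = 0 := hJ hx l.partner hls
    have j4 : (loop w y).jump l.partner = 0 := hJ hy l.partner hls
    have hlw' := hw.partner_mem l hlw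
    have hxw := hvw hx
    have hyw := hvw hy
    simp only [pairingAt, Chain.outflow, j1, j2, j3, j4, Letter.isFirst_partner,
      Letter.partner_partner, add_zero]
    rcases inflow_loop_eq_zero_or_one hw.nodup hxw (hw.partner_mem x hxw) hlw with e1 | e1 <;>
    rcases inflow_loop_eq_zero_or_one hw.nodup hxw (hw.partner_mem x hxw) hlw' with e2 | e2 <;>
    rcases inflow_loop_eq_zero_or_one hw.nodup hyw (hw.partner_mem y hyw) hlw with e3 | e3 <;>
    rcases inflow_loop_eq_zero_or_one hw.nodup hyw (hw.partner_mem y hyw) hlw' with e4 | e4 <;>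
    rw [e1, e2, e3, e4] <;> cases l.isFirst <;> decide
  have h3 := length_eq_two_mul_overs hzG
  have h4 : (overs z).length = V.numVirtual := by
    rw [hz, overs, List.filter_filter, VirtualDiagram.numVirtual, overs, List.filter_filter]
    simp only [s, Bool.not_not, Bool.and_comm, hwdef]
  rw [h3, h4, ← two_mul, abs_mul, abs_two] at h2
  have h5 : linking v x y = -(z.map (pairingAt w (loop w x) (loop w y))).sum := by
    rw [h1]; linarith
  rw [h5, abs_neg]
  push_cast at h2
  linarith

/-! ### Degrees -/

/-- The Laurent polynomials without exponents above `N`. -/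
def exponentsLE (N : ℤ) : AddSubgroup ℤ[T;T⁻¹] where
  carrier := {g | ∀ k, N < k → g.coeff k = 0}
  zero_mem' _ _ := rfl
  add_mem' ha hb k hk := by simp [ha k hk, hb k hk]
  neg_mem' ha k hk := by simp [ha k hk]

theorem mem_exponentsLE {N : ℤ} {g : ℤ[T;T⁻¹]} :
    g ∈ exponentsLE N ↔ ∀ k, N < k → g.coeff k = 0 := Iff.rfl

theorem T_mem_exponentsLE {N k : ℤ} (h : k ≤ N) : (T k : ℤ[T;T⁻¹]) ∈ exponentsLE N := by
  rw [mem_exponentsLE]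
  intro m hm
  rw [T_apply, if_neg (by omega)]

/-- The bound must be nonnegative because of the constant term `-1`. -/
theorem T_sub_one_mem_exponentsLE {N k : ℤ} (h0 : 0 ≤ N) (h : k ≤ N) :
    (T k - 1 : ℤ[T;T⁻¹]) ∈ exponentsLE N :=
  sub_mem (T_mem_exponentsLE h) (by rw [← T_zero]; exact T_mem_exponentsLE h0)

theorem singleSum_mem_exponentsLE {N : ℤ} (h0 : 0 ≤ N) {C : List Letter} {g : Letter → ℤ}
    (h : ∀ x ∈ C, g x ≤ N) : singleSum C g ∈ exponentsLE N := by
  apply AddSubgroup.list_sum_mem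
  intro q hq
  obtain ⟨x, hx, rfl⟩ := List.mem_map.1 hq
  exact zsmul_mem (T_sub_one_mem_exponentsLE h0 (h x hx)) _

theorem doubleSum_mem_exponentsLE {N : ℤ} (h0 : 0 ≤ N) {C : List Letter}
    {E : Letter → Letter → ℤ} (h : ∀ x ∈ C, ∀ y ∈ C, E x y ≤ N) :
    doubleSum C E ∈ exponentsLE N := by
  apply AddSubgroup.list_sum_mem
  intro q hq
  obtain ⟨x, hx, rfl⟩ := List.mem_map.1 hq
  apply AddSubgroup.list_sum_mem
  intro q hq
  obtain ⟨y, hy, rfl⟩ := List.mem_map.1 hq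
  exact zsmul_mem (T_sub_one_mem_exponentsLE h0 (h x hx y hy)) _

theorem maxDeg_le_of_mem_exponentsLE {n : ℕ} {g : ℤ[T;T⁻¹]} (h : g ∈ exponentsLE n) :
    maxDeg g ≤ ((n : ℝ) : EReal) := by
  apply Finset.sup_le
  intro k hk
  have hk' : k ≤ n := by
    by_contra hlt
    exact Finsupp.mem_support_iff.1 hk (h k (by omega))
  exact EReal.coe_le_coe_iff.2 (by exact_mod_cast hk')

namespace VirtualDiagram

variable (V : VirtualDiagram)

theorem abs_index_sub_linking_le {x y : Letter} (hx : x ∈ V.gaussDiagram.crossings)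
    (hy : y ∈ V.gaussDiagram.crossings) :
    |index V.gaussDiagram.code x - linking V.gaussDiagram.code x y| ≤ V.numVirtual := by
  rw [← linking_partner_right V.gaussDiagram.isGaussCode x (mem_of_mem_overs hy)]
  exact V.abs_linking_le (mem_of_mem_overs hx) (V.gaussDiagram.partner_mem hy)

theorem abs_index_le {x : Letter} (hx : x ∈ V.gaussDiagram.crossings) :
    |index V.gaussDiagram.code x| ≤ V.numVirtual := by
  simpa [linking_self V.gaussDiagram.isGaussCode] using V.abs_index_sub_linking_le hx hx

/-- The indices occur with both signs, so the two-sided bound on them is needed. -/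
theorem symSum_mem_exponentsLE :
    symSum V.gaussDiagram.crossings (index V.gaussDiagram.code) ∈ exponentsLE V.numVirtual :=
  add_mem
    (singleSum_mem_exponentsLE (by positivity) fun _ hx => (abs_le.1 (V.abs_index_le hx)).2)
    (singleSum_mem_exponentsLE (by positivity) fun _ hx => by
      have := (abs_le.1 (V.abs_index_le hx)).1
      omega)

theorem doubleSum_linking_mem_exponentsLE :
    doubleSum V.gaussDiagram.crossings (linking V.gaussDiagram.code) ∈
      exponentsLE V.numVirtual :=
  doubleSum_mem_exponentsLE (by positivity) fun _ hx _ hy =>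
    (abs_le.1 (V.abs_linking_le (mem_of_mem_overs hx) (mem_of_mem_overs hy))).2

theorem polyI_mem_exponentsLE : V.gaussDiagram.polyI ∈ exponentsLE V.numVirtual := by
  rw [GaussDiagram.polyI_eq]
  exact sub_mem (doubleSum_mem_exponentsLE (by positivity) fun _ hx _ hy =>
      (abs_le.1 (V.abs_index_sub_linking_le hx hy)).2)
    (zsmul_mem (singleSum_mem_exponentsLE (by positivity) fun _ hx =>
      (abs_le.1 (V.abs_index_le hx)).2) _)

theorem polyII_mem_exponentsLE : V.gaussDiagram.polyII ∈ exponentsLE V.numVirtual := by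
  rw [GaussDiagram.polyII_eq]
  refine sub_mem (add_mem V.doubleSum_linking_mem_exponentsLE
    (doubleSum_mem_exponentsLE (by positivity) fun x hx y hy => ?_))
    (zsmul_mem V.symSum_mem_exponentsLE _)
  -- The exponent is the intersection number `γ̄ x · γ̄ y`, again one of two cycles at real
  -- crossings.
  rw [← linking_partner_partner V.gaussDiagram.isGaussCode (mem_of_mem_overs hx)
    (mem_of_mem_overs hy)]
  exact (abs_le.1 (V.abs_linking_le (V.gaussDiagram.partner_mem hx)
    (V.gaussDiagram.partner_mem hy))).2

/-- Both `f00` and `Wbar` satisfy the bound, so it holds uniformly in the multiple `m` and passes to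
the supremum over the class. -/
theorem mem_exponentsLE_of_mem_classIII {g : ℤ[T;T⁻¹]} (hg : g ∈ V.gaussDiagram.classIII) :
    g ∈ exponentsLE V.numVirtual := by
  obtain ⟨m, hm⟩ := hg
  rw [GaussDiagram.f00_eq, GaussDiagram.Wbar_eq, sub_eq_iff_eq_add] at hm
  rw [hm]
  exact add_mem (zsmul_mem V.symSum_mem_exponentsLE m) V.doubleSum_linking_mem_exponentsLE

end VirtualDiagram

/-- The virtual crossing number is attained, unless the knot has no virtual diagram. -/
theorem virtualCrossingNumber_eq_top_or (K : VirtualKnot) : virtualCrossingNumber K = ⊤ ∨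
    ∃ V : VirtualDiagram, V.gaussDiagram.Presents K ∧ virtualCrossingNumber K = V.numVirtual := by
  by_cases h : Nonempty {V : VirtualDiagram // V.gaussDiagram.Presents K}
  · right
    have := ciInf_mem fun V : {V : VirtualDiagram // V.gaussDiagram.Presents K} =>
      (V.1.numVirtual : ℕ∞)
    obtain ⟨V, hV⟩ := this
    exact ⟨V.1, V.2, by rw [virtualCrossingNumber, iInf_subtype']; exact hV.symm⟩
  · left
    rw [virtualCrossingNumber]
    simp only [iInf_eq_top]
    exact fun V hV => absurd ⟨⟨V, hV⟩⟩ h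

end VirtualKnots

/-! ### The degree bounds. -/

theorem proposition5p4 (K : VirtualKnots.VirtualKnot) (D : VirtualKnots.GaussDiagram)
    (hD : D.Presents K) :
    VirtualKnots.maxDeg D.polyI ≤
        (((VirtualKnots.virtualCrossingNumber K : ℕ∞) : ENNReal) : EReal) ∧
      VirtualKnots.maxDeg D.polyII ≤
        (((VirtualKnots.virtualCrossingNumber K : ℕ∞) : ENNReal) : EReal) ∧
      VirtualKnots.maxDegClass D.classIII ≤
        (((VirtualKnots.virtualCrossingNumber K : ℕ∞) : ENNReal) : EReal) := by
  rcases VirtualKnots.virtualCrossingNumber_eq_top_or K with h | ⟨V, hV, h⟩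
  · rw [h]
    simp
  -- By invariance `D` may be replaced by the Gauss diagram of a virtual diagram `V` with the
  -- minimal number of virtual crossings.
  · have e : Quot.mk VirtualKnots.Move D = Quot.mk VirtualKnots.Move V.gaussDiagram :=
      Eq.trans hD hV.symm
    have hn : ((((V.numVirtual : ℕ) : ℕ∞) : ENNReal) : EReal) = ((V.numVirtual : ℝ) : EReal) := by
      rw [ENat.toENNReal_coe, ← ENNReal.coe_natCast, EReal.coe_nnreal_eq_coe_real,
        NNReal.coe_natCast]
    rw [h, hn, VirtualKnots.polyI_eq_of_mk_eq e, VirtualKnots.polyII_eq_of_mk_eq e,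
      VirtualKnots.classIII_eq_of_mk_eq e]
    exact ⟨VirtualKnots.maxDeg_le_of_mem_exponentsLE V.polyI_mem_exponentsLE,
      VirtualKnots.maxDeg_le_of_mem_exponentsLE V.polyII_mem_exponentsLE,
      iSup₂_le fun g hg => VirtualKnots.maxDeg_le_of_mem_exponentsLE
        (V.mem_exponentsLE_of_mem_classIII hg)⟩
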